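/- Let $d\ge 1$, $m,n\ge 0$, $p=m+n$, and let $\eta(x)=(\eta_1(x),\dots,\eta_{p}(x))$, $x\in\mathbb{R}^d$, be a measurable homogeneous isotropic Gaussian vector random field with independent components, zero mean and unit variances, such that for $x\ne y$ $$\mathbf{Cov}(\eta_j(x),\eta_j(y))=\|x-y\|^{-e_j}L_j(\|x-y\|),\qquad j=1,\dots,p,$$ where $e_i=\beta_i>d$ for $i=1,\dots,m$ (weakly dependent components), $e_j=\alpha_j\in(0,d)$ for $j=m+1,\dots,m+n$ (strongly dependent components), and $L_1,\dots,L_p:(0,\infty)\to(0,\infty)$ are measurable functions slowly varying at infinity. Let $\Delta\subset\mathbb{R}^d$ be a Jordan-measurable compact connected set of positive Lebesgue measure containing the origin in its interior, and $\Delta(r)=r\Delta$. Let $\phi_p$ be the standard Gaussian density on $\mathbb{R}^p$ and $G\in L_2(\mathbb{R}^p,\phi_p(w)\,dw)$. For $v=(k_1,\dots,k_p)\in\mathbb{Z}_{\ge0}^p$ put $|v|=\sum_j k_j$, $v!=\prod_j k_j!$, $e_v(w)=\prod_j H_{k_j}(w_j)$, where $H_k$ are the (probabilists') Hermite polynomials,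 and $C_v=\int_{\mathbb{R}^p} G(w)e_v(w)\phi_p(w)\,dw$. Assume that $C_0=0$ and that $G$ has Hermite rank $\kappa\ge1$, i.e. $\kappa$ is the smallest integer $k\geq 1$ such that $C_v\neq0$ for some $v$ with $|v|=k$. Define $$K_r=\int_{\Delta(r)}G(\eta(x))\,dx,\qquad N_+=\{v:\ |v|\ge\kappa,\ C_v\ne0\},\qquad \tilde\gamma=\min_{v\in N_+}\sum_{j=1}^{p}e_jk_j,$$ $$\tilde N_l^*=\Big\{v\in N_+:\ |v|=l,\ \sum_{j=1}^{p} e_jk_j=\tilde\gamma\Big\},\qquad \tilde{\mathcal L}_+=\{l\ge\kappa:\ \tilde N_l^*\ne\varnothing\},\qquad \tilde K^*_{r,l}=\sum_{v\in\tilde N_l^*}\frac{C_v}{v!}\int_{\Delta(r)}e_v(\eta(x))\,dx .$$ The set $\tilde{\mathcal L}_+$ is finite. Suppose $\tilde\gamma<d$. If, as $r\to\infty$, a limit distribution exists for at least one of the random variables $$\frac{K_r}{\sqrt{\mathbf{Var}(K_r)}}\qquad\text{and}\qquad \frac{\sum_{l\in\tilde{\mathcal L}_+}\tilde K^*_{r,l}}{\sqrt{\mathbf{Var}\big(\sum_{l\in\tilde{\mathcal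 L}_+}\tilde K^*_{r,l}\big)}},$$ then the limit distribution of the other random variable exists as well, and the two limit distributions coincide. -/

import Mathlib

open MeasureTheory ProbabilityTheory Filter Topology
open scoped Pointwise

noncomputable section

namespace HermiteReduction

/-- A measurable function `L : (0,∞) → (0,∞)` (given as a function on `ℝ` of which only the values on
`(0,∞)` matter) that is slowly varying at infinity. -/
structure SlowlyVarying (L : ℝ → ℝ) : Prop where
  measurable : Measurable fun t : Set.Ioi (0 : ℝ) ↦ L t
  pos : ∀ t, 0 < t → 0 < L t
  tendsto : ∀ t, 0 < t → Tendsto (fun r ↦ L (t * r) / L r) atTop (𝓝 1)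

/-- The observation window: a Jordan-measurable compact connected set of positive Lebesgue measure
with the origin in its interior. -/
structure IsWindow {d : ℕ} (Δ : Set (EuclideanSpace ℝ (Fin d))) : Prop where
  isCompact : IsCompact Δ
  isConnected : IsConnected Δ
  jordan : volume (frontier Δ) = 0
  volume_pos : 0 < volume Δ
  zero_mem : (0 : EuclideanSpace ℝ (Fin d)) ∈ interior Δ

/-- A measurable, centred, unit variance Gaussian vector random field on `ℝ^d` with components indexed by
`ι`, whose components are independent, homogeneous and isotropic, the `j`-th one having the
covariance function `ρ ↦ ρ ^ (-e j) * L j ρ`, `ρ > 0`. -/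
structure IsGaussianVectorField {d : ℕ} {ι Ω : Type*} [Fintype ι] [MeasurableSpace Ω]
    (P : Measure Ω) (η : ι → EuclideanSpace ℝ (Fin d) → Ω → ℝ) (e : ι → ℝ) (L : ι → ℝ → ℝ) :
    Prop where
  measurable : ∀ j, Measurable (Function.uncurry (η j))
  gaussian : IsGaussianProcess
    (fun p : ι × EuclideanSpace ℝ (Fin d) ↦ η p.1 p.2) P
  indep : iIndepFun (fun j ω ↦ (fun x : EuclideanSpace ℝ (Fin d) ↦ η j x ω)) P
  mean_zero : ∀ j x, ∫ ω, η j x ω ∂P = 0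
  variance_one : ∀ j x, variance (η j x) P = 1
  covariance_eq : ∀ j x y, x ≠ y →
    covariance (η j x) (η j y) P = ‖x - y‖ ^ (-e j) * L j ‖x - y‖

section Hermite

variable {ι : Type*} [Fintype ι]

/-- The product `e_v(w) = ∏ H_{k_j}(w_j)` of probabilists' Hermite polynomials, `v = (k_j)`. -/
def hermiteProd (v : ι → ℕ) (w : ι → ℝ) : ℝ :=
  ∏ j, Polynomial.aeval (w j) (Polynomial.hermite (v j))

/-- The standard Gaussian measure `φ(‖w‖) dw` on `ℝ^ι`. -/
def stdGaussianMeasure (ι : Type*) [Fintype ι] : Measure (ι → ℝ) :=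
  Measure.pi fun _ ↦ gaussianReal 0 1

/-- The Hermite coefficient `C_v = ∫ G(w) e_v(w) φ(‖w‖) dw`. -/
def hermiteCoeff (G : (ι → ℝ) → ℝ) (v : ι → ℕ) : ℝ :=
  ∫ w, G w * hermiteProd v w ∂(stdGaussianMeasure ι)

/-- `κ ≥ 1` is the Hermite rank of `G`. -/
structure IsHermiteRank (G : (ι → ℝ) → ℝ) (κ : ℕ) : Prop where
  one_le : 1 ≤ κ
  coeff_eq_zero : ∀ v : ι → ℕ, 1 ≤ ∑ j, v j → ∑ j, v j < κ → hermiteCoeff G v = 0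
  exists_coeff_ne_zero : ∃ v : ι → ℕ, ∑ j, v j = κ ∧ hermiteCoeff G v ≠ 0

/-- `N₊`: multi-indices of order at least `κ` with nonzero Hermite coefficient. -/
def Nplus (G : (ι → ℝ) → ℝ) (κ : ℕ) : Set (ι → ℕ) :=
  {v | κ ≤ ∑ j, v j ∧ hermiteCoeff G v ≠ 0}

/-- The decay exponent `∑ e_j k_j` of the covariance of `e_v(η(x))`. -/
def exponentSum (e : ι → ℝ) (v : ι → ℕ) : ℝ := ∑ j, e j * (v j : ℝ)

open Classical in
/-- `Ñ*_l`: the multi-indices `v ∈ N₊` of order `l` with `∑ e_j k_j = γ`. -/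
def Nstar (G : (ι → ℝ) → ℝ) (κ : ℕ) (e : ι → ℝ) (γ : ℝ) (l : ℕ) : Finset (ι → ℕ) :=
  (Finset.piAntidiag Finset.univ l).filter fun v ↦ v ∈ Nplus G κ ∧ exponentSum e v = γ

/-- `L̃₊`: the levels `l ≥ κ` at which `Ñ*_l` is nonempty. -/
def Lplus (G : (ι → ℝ) → ℝ) (κ : ℕ) (e : ι → ℝ) (γ : ℝ) : Set ℕ :=
  {l | κ ≤ l ∧ (Nstar G κ e γ l).Nonempty}

theorem mem_Nstar {G : (ι → ℝ) → ℝ} {κ : ℕ} {e : ι → ℝ} {γ : ℝ} {l : ℕ} {v : ι → ℕ} :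
    v ∈ Nstar G κ e γ l ↔ ∑ j, v j = l ∧ v ∈ Nplus G κ ∧ exponentSum e v = γ := by
  classical
  simp [Nstar]

/-- For positive exponents the set `L̃₊` is finite, so that finite sums over it make sense. -/
theorem Lplus_finite (G : (ι → ℝ) → ℝ) (κ : ℕ) (e : ι → ℝ) (γ : ℝ) (he : ∀ j, 0 < e j) :
    (Lplus G κ e γ).Finite := by
  obtain ⟨c, hc, hce⟩ : ∃ c : ℝ, 0 < c ∧ ∀ j, c ≤ e j := by
    rcases isEmpty_or_nonempty ι with h | h
    · exact ⟨1, one_pos, fun j ↦ (h.false j).elim⟩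
    · obtain ⟨j, hj⟩ := Finite.exists_min e
      exact ⟨e j, he j, hj⟩
  refine (Set.finite_Iic ⌊γ / c⌋₊).subset ?_
  rintro l ⟨-, v, hv⟩
  obtain ⟨rfl, -, hv⟩ := mem_Nstar.1 hv
  refine Nat.le_floor ?_
  rw [le_div_iff₀ hc, ← hv, exponentSum, Nat.cast_sum, Finset.sum_mul]
  refine Finset.sum_le_sum fun j _ ↦ ?_
  rw [mul_comm]
  exact mul_le_mul_of_nonneg_right (hce j) (Nat.cast_nonneg _)

variable {d : ℕ} {Ω : Type*}

/-- `∫_{Δ(r)} F(η(x)) dx` with `Δ(r) = r Δ`, as a function of `ω`. -/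
def windowIntegral (Δ : Set (EuclideanSpace ℝ (Fin d)))
    (η : ι → EuclideanSpace ℝ (Fin d) → Ω → ℝ) (F : (ι → ℝ) → ℝ) (r : ℝ) (ω : Ω) : ℝ :=
  ∫ x in r • Δ, F (fun j ↦ η j x ω)

/-- `K̃*_{r,l} = ∑_{v ∈ Ñ*_l} (C_v / v!) ∫_{Δ(r)} e_v(η(x)) dx`. -/
def Kstar (Δ : Set (EuclideanSpace ℝ (Fin d))) (η : ι → EuclideanSpace ℝ (Fin d) → Ω → ℝ)
    (G : (ι → ℝ) → ℝ) (κ : ℕ) (e : ι → ℝ) (γ : ℝ) (l : ℕ) (r : ℝ) (ω : Ω) : ℝ :=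
  ∑ v ∈ Nstar G κ e γ l,
    hermiteCoeff G v / (∏ j, ((v j).factorial : ℝ)) * windowIntegral Δ η (hermiteProd v) r ω

/-- `∑_{l ∈ L̃₊} K̃*_{r,l}`. -/
def KstarSum (Δ : Set (EuclideanSpace ℝ (Fin d))) (η : ι → EuclideanSpace ℝ (Fin d) → Ω → ℝ)
    (G : (ι → ℝ) → ℝ) (κ : ℕ) (e : ι → ℝ) (γ : ℝ) (r : ℝ) (ω : Ω) : ℝ :=
  ∑ᶠ l ∈ Lplus G κ e γ, Kstar Δ η G κ e γ l r ω

end Hermite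

/-- As `r → ∞`, the normalized variables `X_r / √Var X_r` converge in distribution to the law `μ`. -/
def NormalizedLimit {Ω : Type*} [MeasurableSpace Ω] (P : Measure Ω) [IsProbabilityMeasure P]
    (X : ℝ → Ω → ℝ) (μ : Measure ℝ) [IsProbabilityMeasure μ] : Prop :=
  TendstoInDistribution (fun r ω ↦ X r ω / √(variance (X r) P)) atTop (id : ℝ → ℝ)
    (fun _ ↦ P) μ

end HermiteReduction

end

/-! The Hermite products are complete and orthogonal in `L²` of the Gaussian measure, and by Stein's
identity `e_u(η(x))` and `e_v(η(y))` are uncorrelated for `u ≠ v`, with covariance `v! ∏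
ρ_j(x,y)^{k_j}` for `u = v`, where `ρ_j` is the correlation of the `j`-th component. Hence the
second moment of a Hermite sum integrated over `Δ(r)` is a sum of nonnegative terms `C_v²/v! ·
I_v(r)`, where `I_v(r)` (`covInt`) is the integral of `∏ ρ_j^{k_j}` over `Δ(r) × Δ(r)`.

Fix `v₀` of minimal exponent `γ < d`. The kernel of `I_{v₀}` is a slowly varying function times
`ρ^{-γ}`, so `I_{v₀}(r)` outgrows `r^d`. If `u` has a larger exponent, its kernel is negligible
against that of `v₀` at large distances, because a slowly varying function cannot undo a power;
pairs at bounded distance contribute only `O(r^d)`. Thus `I_u = o(I_{v₀})`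
(`eventually_covInt_le_mul`).

This must hold uniformly over infinitely many `u`. All correlations lie in `[0,1]`, so `I_u`
decreases in `u`, and by Dickson's lemma the multi-indices of exponent above `γ` have finitely many
minimal elements (`eventually_forall_covInt_le_mul`). With Bessel's inequality the remainder of
`K_r` is then `o(Var)` of the leading part in squared `L²` norm (`integral_sq_integral_sub_le`), so
the normalized variables differ by a term tending to `0` in `L²`, and Slutsky's theorem transfers
limits both ways. No exact asymptotics of `I_v` are needed. -/

namespace HermiteReduction

/-! ### Slowly varying functions against powers -/

section SlowVariation

/-- The uniform convergence theorem for additively slowly varying measurable functions. -/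
theorem eventually_forall_abs_sub_lt {h : ℝ → ℝ} (hm : Measurable h)
    (hh : ∀ u, Tendsto (fun x ↦ h (x + u) - h x) atTop (𝓝 0)) {ε : ℝ} (hε : 0 < ε) :
    ∀ᶠ x in atTop, ∀ u ∈ Set.Icc (0 : ℝ) 1, |h (x + u) - h x| < ε := by
  set bad : ℝ → Set ℝ := fun x ↦ {t | t ∈ Set.Icc (0 : ℝ) 2 ∧ ε / 2 ≤ |h (x + t) - h x|} with hbad
  have hbm : ∀ x, MeasurableSet (bad x) := fun x ↦ by
    refine measurableSet_Icc.inter ?_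
    exact measurableSet_le measurable_const
      (((hm.comp (measurable_const_add x)).sub_const _).abs)
  have hsub : ∀ x, bad x ⊆ Set.Icc (0 : ℝ) 2 := fun x t ht ↦ ht.1
  have hlim : Tendsto (fun x ↦ volume (bad x)) atTop (𝓝 0) := by
    have := tendsto_measure_of_tendsto_indicator (μ := volume) (A := (∅ : Set ℝ)) (As := bad)
      (L := atTop) (B := Set.Icc 0 2) hbm measurableSet_Icc (by simp)
      (Eventually.of_forall hsub) (fun t ↦ ?_)
    · rwa [measure_empty] at this
    · have h1 := (hh t).abs
      rw [abs_zero] at h1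
      filter_upwards [h1.eventually (gt_mem_nhds (half_pos hε))] with x hx
      simp only [hbad, Set.mem_ofPred_eq, Set.mem_empty_iff_false, iff_false, not_and, not_le]
      exact fun _ ↦ hx
  have hev : ∀ᶠ x in atTop, volume (bad x) < ENNReal.ofReal (1 / 4) :=
    hlim.eventually (gt_mem_nhds (by simp))
  obtain ⟨X, hX⟩ := eventually_atTop.1 hev
  filter_upwards [eventually_ge_atTop X] with x hx u hu
  have h1 := hX x hx
  have h2 := hX (x + u) (by linarith [hu.1])
  set shifted : Set ℝ := (fun t ↦ t - u) ⁻¹' bad (x + u)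
  have h3 : volume shifted = volume (bad (x + u)) := by
    simp [shifted, sub_eq_add_neg]
  -- The interval `[1,2]` lies in both `[0,2]` and `u + [0,2]`, and two bad sets of measure below
  -- `1/4` cannot cover it. A remaining `t` makes `h (x + t)` close to both `h x` and `h (x + u)`.
  obtain ⟨t, ht, htn⟩ : ∃ t ∈ Set.Icc (1 : ℝ) 2, t ∉ bad x ∪ shifted := by
    by_contra! hcon
    have h4 : volume (Set.Icc (1 : ℝ) 2) ≤ volume (bad x ∪ shifted) := measure_mono hcon
    have h5 := h4.trans (measure_union_le _ _)
    rw [h3, Real.volume_Icc] at h5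
    have h6 := h5.trans_lt (ENNReal.add_lt_add h1 h2)
    rw [← ENNReal.ofReal_add (by norm_num) (by norm_num),
      ENNReal.ofReal_lt_ofReal_iff (by norm_num)] at h6
    norm_num at h6
  simp only [Set.mem_union, not_or, hbad, Set.mem_ofPred_eq, not_and, not_le, shifted,
    Set.mem_preimage] at htn
  have ha := htn.1 ⟨by linarith [ht.1], ht.2⟩
  have hb := htn.2 ⟨by linarith [ht.1, hu.2], by linarith [ht.2, hu.1]⟩
  rw [show x + u + (t - u) = x + t by ring] at hb
  rw [abs_lt] at *
  constructor <;> linarith [ha.1, ha.2, hb.1, hb.2]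

/-- By uniform convergence `h` falls by less than `ε` over any step of length at most one far out,
so its decrease is at most linear with slope `ε`. -/
theorem exists_sub_mul_le {h : ℝ → ℝ} (hm : Measurable h)
    (hh : ∀ u, Tendsto (fun x ↦ h (x + u) - h x) atTop (𝓝 0)) {ε : ℝ} (hε : 0 < ε) :
    ∃ c : ℝ, ∀ᶠ x in atTop, c - ε * x ≤ h x := by
  obtain ⟨X, hX⟩ := eventually_atTop.1 (eventually_forall_abs_sub_lt hm hh hε)
  have key : ∀ k : ℕ, ∀ x ∈ Set.Icc (X + k) (X + k + 1), h X - ε * (k + 1) ≤ h x := by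
    intro k
    induction k with
    | zero =>
      intro x hx
      have := hX X le_rfl (x - X) ⟨by simpa using hx.1,
        by linarith [hx.2, (Nat.cast_zero (R := ℝ))]⟩
      rw [add_sub_cancel, abs_lt] at this
      simp only [Nat.cast_zero, zero_add, mul_one]
      linarith [this.1]
    | succ k ih =>
      intro x hx
      push_cast at hx ⊢
      have h1 := ih (x - 1) ⟨by linarith [hx.1], by linarith [hx.2]⟩
      have h2 := hX (x - 1) (by linarith [hx.1, (Nat.cast_nonneg k : (0 : ℝ) ≤ k)]) 1 (by simp)
      rw [sub_add_cancel, abs_lt] at h2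
      linarith [h2.1]
  -- With `k = ⌊x - X⌋₊ ≤ x - X`, the bound `h X - ε * (k + 1)` is at least `h X - ε * (1 - X) - ε *
  -- x`.
  refine ⟨h X - ε * (1 - X), ?_⟩
  filter_upwards [eventually_ge_atTop X] with x hx
  have h0 : 0 ≤ x - X := by linarith
  have h1 := Nat.floor_le h0
  have h2 := Nat.lt_floor_add_one (x - X)
  have h3 := key ⌊x - X⌋₊ x ⟨by linarith, by linarith⟩
  nlinarith

/-- In logarithmic coordinates `h x = log (L (exp x))` is additively slowly varying. Its possible
decrease of slope `ε / 2` is beaten by the term `ε * x` coming from the power. -/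
theorem SlowlyVarying.tendsto_rpow_mul_atTop {L : ℝ → ℝ} (hL : SlowlyVarying L) {ε : ℝ}
    (hε : 0 < ε) : Tendsto (fun r ↦ r ^ ε * L r) atTop atTop := by
  set h : ℝ → ℝ := fun x ↦ Real.log (L (Real.exp x)) with hh
  have hm : Measurable h := by
    have : Measurable fun x : ℝ ↦ (⟨Real.exp x, Real.exp_pos x⟩ : Set.Ioi (0 : ℝ)) :=
      Real.measurable_exp.subtype_mk
    exact Real.measurable_log.comp (hL.measurable.comp this)
  have hlim : ∀ u, Tendsto (fun x ↦ h (x + u) - h x) atTop (𝓝 0) := by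
    intro u
    have h1 := (hL.tendsto (Real.exp u) (Real.exp_pos u)).comp Real.tendsto_exp_atTop
    have h2 := (Real.continuousAt_log one_ne_zero).tendsto.comp h1
    rw [Real.log_one] at h2
    refine h2.congr fun x ↦ ?_
    simp only [Function.comp, hh]
    rw [← Real.exp_add, Real.log_div (hL.pos _ (Real.exp_pos _)).ne'
      (hL.pos _ (Real.exp_pos _)).ne', add_comm u x]
  obtain ⟨c, hc⟩ := exists_sub_mul_le hm hlim (half_pos hε)
  have hmain : Tendsto (fun x ↦ ε * x + h x) atTop atTop := by
    refine tendsto_atTop_mono' _ ?_ (tendsto_atTop_add_const_left _ c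
      (tendsto_id.const_mul_atTop (half_pos hε)))
    filter_upwards [hc] with x hx
    simp only [id]
    linarith
  refine (Real.tendsto_exp_atTop.comp (hmain.comp Real.tendsto_log_atTop)).congr' ?_
  filter_upwards [eventually_gt_atTop 0] with r hr
  simp only [Function.comp, hh]
  rw [Real.exp_add, Real.exp_log hr, Real.exp_log (hL.pos r hr), Real.rpow_def_of_pos hr,
    mul_comm ε]

theorem SlowlyVarying.one : SlowlyVarying fun _ ↦ 1 :=
  ⟨measurable_const, fun _ _ ↦ one_pos, fun _ _ ↦ by simp⟩

theorem SlowlyVarying.mul {L M : ℝ → ℝ} (hL : SlowlyVarying L) (hM : SlowlyVarying M) :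
    SlowlyVarying fun t ↦ L t * M t := by
  refine ⟨hL.measurable.mul hM.measurable, fun t ht ↦ mul_pos (hL.pos t ht) (hM.pos t ht),
    fun t ht ↦ ?_⟩
  have := (hL.tendsto t ht).mul (hM.tendsto t ht)
  rw [one_mul] at this
  exact this.congr fun r ↦ by rw [div_mul_div_comm]

theorem SlowlyVarying.inv {L : ℝ → ℝ} (hL : SlowlyVarying L) :
    SlowlyVarying fun t ↦ (L t)⁻¹ := by
  refine ⟨hL.measurable.inv, fun t ht ↦ inv_pos.2 (hL.pos t ht), fun t ht ↦ ?_⟩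
  have := (hL.tendsto t ht).inv₀ one_ne_zero
  rw [inv_one] at this
  exact this.congr fun r ↦ by rw [inv_div, div_eq_mul_inv, div_eq_mul_inv, inv_inv, mul_comm]

theorem SlowlyVarying.pow {L : ℝ → ℝ} (hL : SlowlyVarying L) (k : ℕ) :
    SlowlyVarying fun t ↦ L t ^ k := by
  induction k with
  | zero => simpa using SlowlyVarying.one
  | succ k ih => simpa only [pow_succ] using ih.mul hL

theorem SlowlyVarying.prod {ι : Type*} {L : ι → ℝ → ℝ} (s : Finset ι)
    (hL : ∀ j, SlowlyVarying (L j)) : SlowlyVarying fun t ↦ ∏ j ∈ s, L j t := by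
  classical
  induction s using Finset.induction_on with
  | empty => simpa using SlowlyVarying.one
  | insert a s ha ih => simpa only [Finset.prod_insert ha] using (hL a).mul ih

end SlowVariation

/-! ### Variables with moments of all orders -/

section Moments

open scoped NNReal ENNReal

variable {Ω : Type*} [MeasurableSpace Ω] {P : Measure Ω} {X Y : Ω → ℝ}

/-- Hölder's inequality with exponents `2p, 2p`; this makes the variables with all finite moments an
algebra. -/
theorem memLp_fun_mul (hX : ∀ p : ℝ≥0, MemLp X p P) (hY : ∀ p : ℝ≥0, MemLp Y p P) (p : ℝ≥0) :
    MemLp (fun ω ↦ X ω * Y ω) p P := by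
  have : ENNReal.HolderTriple ((2 * p : ℝ≥0) : ℝ≥0∞) ((2 * p : ℝ≥0) : ℝ≥0∞) p := by
    constructor
    push_cast
    rw [ENNReal.mul_inv (by simp) (by simp), ← add_mul, ENNReal.inv_two_add_inv_two, one_mul]
  exact (hY (2 * p)).mul (hX (2 * p))

theorem memLp_fun_prod {ι : Type*} [IsFiniteMeasure P] {X : ι → Ω → ℝ}
    (hX : ∀ j, ∀ p : ℝ≥0, MemLp (X j) p P) (s : Finset ι) (p : ℝ≥0) :
    MemLp (fun ω ↦ ∏ j ∈ s, X j ω) p P := by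
  classical
  induction s using Finset.induction_on generalizing p with
  | empty => simpa using memLp_const (1 : ℝ)
  | insert a s ha ih => simpa only [Finset.prod_insert ha] using memLp_fun_mul (hX a) ih p

theorem memLp_eval [IsFiniteMeasure P] (hX : ∀ p : ℝ≥0, MemLp X p P) (f : Polynomial ℝ) (p : ℝ≥0) :
    MemLp (fun ω ↦ f.eval (X ω)) p P := by
  induction f using Polynomial.induction_on' generalizing p with
  | add f g hf hg =>
    simp only [Polynomial.eval_add]
    exact (hf p).add (hg p)
  | monomial n a =>
    simp only [Polynomial.eval_monomial]
    refine MemLp.const_mul ?_ a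
    induction n generalizing p with
    | zero => simpa using memLp_const (1 : ℝ)
    | succ n ih => simpa only [pow_succ] using memLp_fun_mul ih hX p

theorem integrable_of_forall_memLp (hX : ∀ p : ℝ≥0, MemLp X p P) : Integrable X P :=
  memLp_one_iff_integrable.1 (by simpa using hX 1)

end Moments

/-! ### Stein's identity and the Hermite diagonal formula -/

section Stein

open scoped NNReal ENNReal

theorem memLp_eval_gaussianReal (f : Polynomial ℝ) (p : ℝ≥0) :
    MemLp (fun x ↦ f.eval x) p (gaussianReal 0 1) :=
  memLp_eval (X := id) (fun q ↦ memLp_id_gaussianReal q) f p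

theorem integrable_eval_mul_gaussianPDFReal (f : Polynomial ℝ) :
    Integrable fun x ↦ f.eval x * gaussianPDFReal 0 1 x := by
  have h := integrable_of_forall_memLp (memLp_eval_gaussianReal f)
  rw [gaussianReal_of_var_ne_zero _ one_ne_zero,
    integrable_withDensity_iff (measurable_gaussianPDF 0 1) (by simp [gaussianPDF_lt_top])] at h
  simpa only [toReal_gaussianPDF] using h

theorem hasDerivAt_gaussianPDFReal (x : ℝ) :
    HasDerivAt (gaussianPDFReal 0 1) (-(x * gaussianPDFReal 0 1 x)) x := by
  rw [gaussianPDFReal_def]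
  have h : HasDerivAt (fun y : ℝ ↦ -(y - 0) ^ 2 / (2 * ((1 : ℝ≥0) : ℝ))) (-x) x := by
    have := (((hasDerivAt_id x).sub_const 0).pow 2).neg.div_const (2 * ((1 : ℝ≥0) : ℝ))
    convert! this using 1
    simp
    ring
  convert! (h.exp.const_mul _) using 1
  ring

/-- Gaussian integration by parts for polynomials. -/
theorem integral_id_mul_eval_gaussianReal (f : Polynomial ℝ) :
    ∫ x, x * f.eval x ∂(gaussianReal 0 1) = ∫ x, f.derivative.eval x ∂(gaussianReal 0 1) := by
  rw [integral_gaussianReal_eq_integral_smul one_ne_zero,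
    integral_gaussianReal_eq_integral_smul one_ne_zero]
  have h := integral_mul_deriv_eq_deriv_mul_of_integrable (A := ℝ)
    (u := fun x ↦ f.eval x) (v := gaussianPDFReal 0 1) (u' := fun x ↦ f.derivative.eval x)
    (v' := fun x ↦ -(x * gaussianPDFReal 0 1 x)) (fun x _ ↦ f.hasDerivAt x)
    (fun x _ ↦ hasDerivAt_gaussianPDFReal x) ?_
    (integrable_eval_mul_gaussianPDFReal _) (integrable_eval_mul_gaussianPDFReal _)
  · simp only [smul_eq_mul]
    rw [← neg_inj, ← integral_neg]
    refine Eq.trans ?_ (h.trans ?_)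
    · exact integral_congr_ae (.of_forall fun x ↦ by ring)
    · rw [neg_inj]
      exact integral_congr_ae (.of_forall fun x ↦ by ring)
  · refine (integrable_eval_mul_gaussianPDFReal (-(Polynomial.X * f))).congr
      (.of_forall fun x ↦ ?_)
    simp only [Polynomial.eval_neg, Polynomial.eval_mul, Polynomial.eval_X, Pi.mul_apply]
    ring

variable {Ω : Type*} [MeasurableSpace Ω] {P : Measure Ω} {X W Y : Ω → ℝ}

/-- Freezing `W = w` by Fubini leaves one-dimensional integration by parts for `f(x) g(ρx + w)`, and
the chain rule yields the factor `ρ`. Everything sits under one integral so that Fubini is applied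
once. -/
theorem integral_stein_of_indepFun [IsProbabilityMeasure P] (hX : P.map X = gaussianReal 0 1)
    (hXm : ∀ p : ℝ≥0, MemLp X p P) (hW : ∀ p : ℝ≥0, MemLp W p P) (hXW : IndepFun X W P)
    (ρ : ℝ) (f g : Polynomial ℝ) :
    ∫ ω, (X ω * (f.eval (X ω) * g.eval (ρ * X ω + W ω))
      - (f.derivative.eval (X ω) * g.eval (ρ * X ω + W ω)
        + ρ * (f.eval (X ω) * g.derivative.eval (ρ * X ω + W ω)))) ∂P = 0 := by
  have hXa := (hXm 0).aestronglyMeasurable.aemeasurable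
  have hWa := (hW 0).aestronglyMeasurable.aemeasurable
  have hZ : ∀ p : ℝ≥0, MemLp (fun ω ↦ ρ * X ω + W ω) p P := fun p ↦ ((hXm p).const_mul ρ).add (hW p)
  have hfg : ∀ f g : Polynomial ℝ, ∀ p : ℝ≥0,
      MemLp (fun ω ↦ f.eval (X ω) * g.eval (ρ * X ω + W ω)) p P := fun f g ↦
    memLp_fun_mul (memLp_eval hXm f) (memLp_eval hZ g)
  set F : ℝ × ℝ → ℝ := fun z ↦ z.1 * (f.eval z.1 * g.eval (ρ * z.1 + z.2))
      - (f.derivative.eval z.1 * g.eval (ρ * z.1 + z.2)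
        + ρ * (f.eval z.1 * g.derivative.eval (ρ * z.1 + z.2))) with hF
  have hFc : Continuous F := by fun_prop
  have hFi : Integrable (fun ω ↦ F (X ω, W ω)) P := by
    have h1 := integrable_of_forall_memLp (memLp_fun_mul hXm (hfg f g))
    have h2 := integrable_of_forall_memLp (hfg f.derivative g)
    have h3 := integrable_of_forall_memLp (hfg f g.derivative)
    exact h1.sub (h2.add (h3.const_mul ρ))
  have hmap := (indepFun_iff_map_prod_eq_prod_map_map hXa hWa).1 hXW
  rw [hX] at hmap
  have hpm : IsProbabilityMeasure (P.map W) := Measure.isProbabilityMeasure_map hWa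
  have hFi' : Integrable F ((gaussianReal 0 1).prod (P.map W)) := by
    rw [← hmap]
    exact (integrable_map_measure hFc.aestronglyMeasurable (hXa.prodMk hWa)).2 hFi
  change ∫ ω, F (X ω, W ω) ∂P = 0
  rw [← integral_map (φ := fun ω ↦ (X ω, W ω)) (hXa.prodMk hWa) hFc.aestronglyMeasurable, hmap,
    integral_prod_symm _ hFi']
  refine integral_eq_zero_of_ae (.of_forall fun w ↦ ?_)
  set q : Polynomial ℝ := f * g.comp (Polynomial.C ρ * Polynomial.X + Polynomial.C w)
  have hq := integral_id_mul_eval_gaussianReal q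
  have hi1 := integrable_of_forall_memLp (memLp_eval_gaussianReal (Polynomial.X * q))
  have hi2 := integrable_of_forall_memLp (memLp_eval_gaussianReal q.derivative)
  simp only [Polynomial.eval_mul, Polynomial.eval_X] at hi1
  rw [← sub_eq_zero, ← integral_sub (by simpa [q] using hi1) hi2] at hq
  refine Eq.trans ?_ hq
  refine integral_congr_ae (.of_forall fun x ↦ ?_)
  simp only [hF, q, Polynomial.eval_mul, Polynomial.eval_comp, Polynomial.eval_add,
    Polynomial.eval_C, Polynomial.eval_X, Polynomial.derivative_mul, Polynomial.derivative_comp,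
    Polynomial.derivative_add, Polynomial.derivative_C, Polynomial.derivative_X,
    Polynomial.eval_zero, Polynomial.eval_one]
  ring

/-- Stein's identity for a pair of jointly Gaussian standard normal variables. -/
theorem integral_stein_pair (hXY : HasGaussianLaw (fun ω ↦ (X ω, Y ω)) P)
    (hX0 : ∫ ω, X ω ∂P = 0) (hX1 : variance X P = 1) (f g : Polynomial ℝ) :
    ∫ ω, (X ω * f.eval (X ω) - f.derivative.eval (X ω)) * g.eval (Y ω) ∂P
      = covariance X Y P * ∫ ω, f.eval (X ω) * g.derivative.eval (Y ω) ∂P := by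
  have := hXY.isProbabilityMeasure
  have hXm : ∀ p : ℝ≥0, MemLp X p P := fun p ↦ hXY.fst.memLp (by simp)
  have hYm : ∀ p : ℝ≥0, MemLp Y p P := fun p ↦ hXY.snd.memLp (by simp)
  set ρ := covariance X Y P with hρ
  -- The regression residual of `Y` on `X` is uncorrelated with `X`, hence independent of it by
  -- joint Gaussianity.
  set W : Ω → ℝ := fun ω ↦ Y ω - ρ * X ω with hWdef
  have hXlaw : P.map X = gaussianReal 0 1 := by
    rw [hXY.fst.map_eq_gaussianReal, hX0, hX1]
    simp
  have hXW : HasGaussianLaw (fun ω ↦ (X ω, W ω)) P := by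
    exact hXY.map_fun ((ContinuousLinearMap.fst ℝ ℝ ℝ).prod
      (ContinuousLinearMap.snd ℝ ℝ ℝ - ρ • ContinuousLinearMap.fst ℝ ℝ ℝ))
  have hcov : covariance X W P = 0 := by
    rw [hWdef, covariance_fun_sub_right (by simpa using hXm 2) (by simpa using hYm 2)
      (by simpa using (hXm 2).const_mul ρ), covariance_const_mul_right,
      covariance_self hXY.fst.aemeasurable, hX1, hρ, mul_one, sub_self]
  have hind := hXW.indepFun_of_covariance_eq_zero hcov
  have key := integral_stein_of_indepFun (W := W) hXlaw hXm
    (fun p ↦ (hYm p).sub ((hXm p).const_mul ρ)) hind ρ f g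
  simp only [hWdef, add_sub_cancel] at key
  have hfg : ∀ f g : Polynomial ℝ, ∀ p : ℝ≥0,
      MemLp (fun ω ↦ f.eval (X ω) * g.eval (Y ω)) p P := fun f g ↦
    memLp_fun_mul (memLp_eval hXm f) (memLp_eval hYm g)
  have h1 := integrable_of_forall_memLp (memLp_fun_mul hXm (hfg f g))
  have h2 := integrable_of_forall_memLp (hfg f.derivative g)
  have h3 := integrable_of_forall_memLp (hfg f g.derivative)
  rw [← integral_const_mul, ← sub_eq_zero, ← integral_sub _ (h3.const_mul ρ), ← key]
  · exact integral_congr_ae (.of_forall fun ω ↦ by ring)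
  · exact (h1.sub h2).congr (.of_forall fun ω ↦ by simp only [Pi.sub_apply]; ring)

/-- The lowering relation, by induction from the recursion `H_{n+1} = X H_n - H_n'`. It complements
that recursion: Stein's identity then lowers both indices of a pair by one. -/
theorem derivative_hermite_succ (n : ℕ) :
    (Polynomial.hermite (n + 1)).derivative = (n + 1) * Polynomial.hermite n := by
  induction n with
  | zero => simp
  | succ n ih =>
    rw [Polynomial.hermite_succ (n + 1), Polynomial.derivative_sub, Polynomial.derivative_mul, ih,
      Polynomial.derivative_X, Polynomial.derivative_mul]
    have h0 : Polynomial.derivative ((n : Polynomial ℤ) + 1) = 0 := by simp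
    rw [h0]
    have := Polynomial.hermite_succ n
    push_cast
    linear_combination (-(n : Polynomial ℤ) - 1) * this

/-- The real Hermite polynomials. -/
noncomputable def hermiteReal (k : ℕ) : Polynomial ℝ :=
  (Polynomial.hermite k).map (Int.castRingHom ℝ)

theorem aeval_hermite (k : ℕ) (x : ℝ) :
    Polynomial.aeval x (Polynomial.hermite k) = (hermiteReal k).eval x := by
  rw [hermiteReal, Polynomial.eval_map]
  rfl

theorem hermiteReal_zero : hermiteReal 0 = 1 := by simp [hermiteReal]

theorem hermiteReal_succ (k : ℕ) :
    hermiteReal (k + 1) = Polynomial.X * hermiteReal k - (hermiteReal k).derivative := by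
  simp [hermiteReal, Polynomial.hermite_succ, Polynomial.derivative_map]

theorem derivative_hermiteReal_succ (k : ℕ) :
    (hermiteReal (k + 1)).derivative = Polynomial.C ((k : ℝ) + 1) * hermiteReal k := by
  rw [hermiteReal, Polynomial.derivative_map, derivative_hermite_succ]
  simp [hermiteReal]

/-- The recursion for `H_{k+1}` is exactly the left side of Stein's identity with `f = H_k`. -/
theorem integral_hermite_succ_mul (hXY : HasGaussianLaw (fun ω ↦ (X ω, Y ω)) P)
    (hX0 : ∫ ω, X ω ∂P = 0) (hX1 : variance X P = 1) (k : ℕ) (g : Polynomial ℝ) :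
    ∫ ω, (hermiteReal (k + 1)).eval (X ω) * g.eval (Y ω) ∂P
      = covariance X Y P * ∫ ω, (hermiteReal k).eval (X ω) * g.derivative.eval (Y ω) ∂P := by
  rw [← integral_stein_pair hXY hX0 hX1]
  simp [hermiteReal_succ]

/-- Diagonal formula for the Hermite polynomials of two jointly Gaussian standard normal
variables. -/
theorem integral_hermite_mul_hermite (hXY : HasGaussianLaw (fun ω ↦ (X ω, Y ω)) P)
    (hX0 : ∫ ω, X ω ∂P = 0) (hX1 : variance X P = 1) (hY0 : ∫ ω, Y ω ∂P = 0)
    (hY1 : variance Y P = 1) (k l : ℕ) :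
    ∫ ω, (hermiteReal k).eval (X ω) * (hermiteReal l).eval (Y ω) ∂P
      = if k = l then (k.factorial : ℝ) * covariance X Y P ^ k else 0 := by
  have := hXY.isProbabilityMeasure
  induction k generalizing l with
  | zero =>
    cases l with
    | zero => simp [hermiteReal_zero]
    | succ l =>
      -- Only `Y` carries a positive index here, so the lowering step is applied to the swapped
      -- pair; the derivative of `1` kills the result.
      have hYX : HasGaussianLaw (fun ω ↦ (Y ω, X ω)) P := by
        simpa using hXY.map_fun ((ContinuousLinearMap.snd ℝ ℝ ℝ).prod (ContinuousLinearMap.fst ℝ ℝ ℝ))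
      have := integral_hermite_succ_mul hYX hY0 hY1 l 1
      simpa [hermiteReal_zero] using this
  | succ k ih =>
    rw [integral_hermite_succ_mul hXY hX0 hX1]
    cases l with
    | zero => simp [hermiteReal_zero]
    | succ l =>
      simp only [derivative_hermiteReal_succ, Polynomial.eval_mul, Polynomial.eval_C]
      simp only [mul_left_comm _ ((l : ℝ) + 1), integral_const_mul, ih l, add_left_inj]
      split_ifs with h
      · subst h
        rw [Nat.factorial_succ]
        push_cast
        ring
      · simp

end Stein

/-! ### Hermite expansions in `L²` of the Gaussian measure -/

section Completeness

open scoped NNReal ENNReal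

variable {ι : Type*} [Fintype ι]

instance : IsProbabilityMeasure (stdGaussianMeasure ι) := by
  unfold stdGaussianMeasure
  infer_instance

theorem hermiteProd_eq (v : ι → ℕ) (w : ι → ℝ) :
    hermiteProd v w = ∏ j, (hermiteReal (v j)).eval (w j) := by
  simp [hermiteProd, aeval_hermite]

theorem memLp_apply_stdGaussianMeasure (j : ι) (p : ℝ≥0) :
    MemLp (fun w : ι → ℝ ↦ w j) p (stdGaussianMeasure ι) :=
  (memLp_id_gaussianReal (μ := 0) (v := 1) p).comp_measurePreserving
    (measurePreserving_eval (fun _ : ι ↦ gaussianReal 0 1) j)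

theorem memLp_hermiteProd (v : ι → ℕ) (p : ℝ≥0) :
    MemLp (hermiteProd v) p (stdGaussianMeasure ι) := by
  simp only [funext (hermiteProd_eq v)]
  exact memLp_fun_prod (fun j ↦ memLp_eval (memLp_apply_stdGaussianMeasure j) _) _ p

/-- The real Hermite polynomials as a sequence of polynomials. -/
noncomputable def hermiteSequence : Polynomial.Sequence ℝ where
  elems' := hermiteReal
  degree_eq' i := by
    rw [hermiteReal, Polynomial.degree_map_eq_of_injective Int.cast_injective,
      Polynomial.degree_hermite]

/-- There is one monic Hermite polynomial in each degree, so they span. This turns orthogonality to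
Hermite products into vanishing of all moments. -/
theorem exists_eval_eq_sum_hermiteReal (p : Polynomial ℝ) :
    ∃ c : ℕ →₀ ℝ, ∀ x, p.eval x = ∑ k ∈ c.support, c k * (hermiteReal k).eval x := by
  have hspan := hermiteSequence.span fun i ↦ by
    change IsUnit (hermiteReal i).leadingCoeff
    rw [hermiteReal, ((Polynomial.hermite_monic i).map _).leadingCoeff]
    exact isUnit_one
  have hp : p ∈ Submodule.span ℝ (Set.range hermiteReal) := by
    change p ∈ Submodule.span ℝ (Set.range hermiteSequence)
    rw [hspan]
    trivial
  obtain ⟨c, hc⟩ := Finsupp.mem_span_range_iff_exists_finsupp.1 hp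
  refine ⟨c, fun x ↦ ?_⟩
  rw [← hc, Finsupp.sum, Polynomial.eval_finsetSum]
  simp

variable {f : (ι → ℝ) → ℝ}

theorem integral_mul_prod_pow_eq_zero (hf : MemLp f 2 (stdGaussianMeasure ι))
    (h0 : ∀ v, ∫ w, f w * hermiteProd v w ∂(stdGaussianMeasure ι) = 0) (k : ι → ℕ) :
    ∫ w, f w * ∏ j, w j ^ k j ∂(stdGaussianMeasure ι) = 0 := by
  classical
  choose c hc using fun j ↦ exists_eval_eq_sum_hermiteReal (Polynomial.X ^ k j)
  have h1 : ∀ w : ι → ℝ, f w * ∏ j, w j ^ k j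
      = ∑ v ∈ Fintype.piFinset fun j ↦ (c j).support,
          (∏ j, c j (v j)) * (f w * hermiteProd v w) := by
    intro w
    have h2 : ∀ j, w j ^ k j = ∑ n ∈ (c j).support, c j n * (hermiteReal n).eval (w j) := fun j ↦ by
      simpa using hc j (w j)
    simp only [h2, Finset.prod_univ_sum, Finset.mul_sum, Finset.prod_mul_distrib, hermiteProd_eq]
    exact Finset.sum_congr rfl fun v _ ↦ by ring
  simp only [h1]
  rw [integral_finsetSum]
  · simp [integral_const_mul, h0]
  · intro v _
    exact (hf.integrable_mul (by simpa using memLp_hermiteProd v 2)).const_mul _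

/-- Cauchy–Schwarz with Gaussian exponential moments; the result dominates the truncated exponential
series below. -/
theorem integrable_mul_prod_exp_abs (hf : MemLp f 2 (stdGaussianMeasure ι)) (a : ι → ℝ) :
    Integrable (fun w ↦ |f w| * ∏ j, Real.exp |a j * w j|) (stdGaussianMeasure ι) := by
  have hc : Continuous fun w : ι → ℝ ↦ ∏ j, Real.exp |a j * w j| := by fun_prop
  refine hf.abs.integrable_mul ((memLp_two_iff_integrable_sq hc.aestronglyMeasurable).2 ?_)
  have h1 : ∀ j : ι, Integrable (fun x : ℝ ↦ Real.exp (2 * |a j| * |x|)) (gaussianReal 0 1) :=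
    fun j ↦ integrable_exp_mul_abs (integrable_exp_mul_gaussianReal _)
      (integrable_exp_mul_gaussianReal _)
  refine (Integrable.fintype_prod (f := fun j x ↦ Real.exp (2 * |a j| * |x|)) h1).congr
    (.of_forall fun w ↦ ?_)
  simp only [← Finset.prod_pow, ← Real.exp_nat_mul, abs_mul]
  exact Finset.prod_congr rfl fun j _ ↦ by push_cast; ring_nf

/-- Products of Taylor partial sums of the exponentials are polynomials, hence orthogonal to `f`;
dominated convergence passes to the exponentials. So the Fourier transform of `f` times the Gaussian
measure vanishes. -/
theorem integral_mul_cexp_eq_zero (hf : MemLp f 2 (stdGaussianMeasure ι))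
    (h0 : ∀ v, ∫ w, f w * hermiteProd v w ∂(stdGaussianMeasure ι) = 0) (a : ι → ℝ) :
    ∫ w, (f w : ℂ) * ∏ j, Complex.exp ((a j * w j : ℝ) * Complex.I) ∂(stdGaussianMeasure ι) = 0 := by
  classical
  set T : ℕ → (ι → ℝ) → ℂ := fun N w ↦
    ∏ j, ∑ n ∈ Finset.range N, ((a j * w j : ℝ) * Complex.I) ^ n / (n.factorial : ℂ) with hT
  have hfm : AEStronglyMeasurable (fun w ↦ (f w : ℂ)) (stdGaussianMeasure ι) :=
    Complex.continuous_ofReal.comp_aestronglyMeasurable hf.aestronglyMeasurable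
  have hlim := tendsto_integral_of_dominated_convergence (μ := stdGaussianMeasure ι)
    (F := fun N w ↦ (f w : ℂ) * T N w)
    (f := fun w ↦ (f w : ℂ) * ∏ j, Complex.exp ((a j * w j : ℝ) * Complex.I))
    (fun w ↦ |f w| * ∏ j, Real.exp |a j * w j|) (fun N ↦ ?_)
    (integrable_mul_prod_exp_abs hf a) (fun N ↦ .of_forall fun w ↦ ?_) (.of_forall fun w ↦ ?_)
  · refine tendsto_nhds_unique hlim ?_
    refine tendsto_const_nhds.congr fun N ↦ ?_
    have h1 : ∀ w : ι → ℝ, (f w : ℂ) * T N w = ∑ k ∈ Fintype.piFinset fun _ : ι ↦ Finset.range N,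
        (∏ j, ((a j : ℂ) * Complex.I) ^ k j / ((k j).factorial : ℂ))
          * ((f w * ∏ j, w j ^ k j : ℝ) : ℂ) := by
      intro w
      simp only [hT, Finset.prod_univ_sum, Finset.mul_sum]
      refine Finset.sum_congr rfl fun k _ ↦ ?_
      push_cast
      rw [mul_left_comm, ← Finset.prod_mul_distrib]
      congr 1
      exact Finset.prod_congr rfl fun j _ ↦ by ring
    simp only [h1]
    rw [integral_finsetSum]
    · refine (Finset.sum_eq_zero fun k _ ↦ ?_).symm
      rw [integral_const_mul, integral_complex_ofReal, integral_mul_prod_pow_eq_zero hf h0]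
      simp
    · intro k _
      have h2 := memLp_fun_prod (P := stdGaussianMeasure ι) (X := fun (j : ι) (w : ι → ℝ) ↦ w j ^ k j)
        (fun j p ↦ by simpa using memLp_eval (memLp_apply_stdGaussianMeasure j) (Polynomial.X ^ k j) p)
        Finset.univ 2
      exact Integrable.const_mul (hf.integrable_mul (by simpa using h2)).ofReal _
  · refine hfm.mul (Continuous.aestronglyMeasurable ?_)
    simp only [hT]
    fun_prop
  · rw [norm_mul, Complex.norm_real, Real.norm_eq_abs, hT, norm_prod]
    refine mul_le_mul_of_nonneg_left (Finset.prod_le_prod (fun _ _ ↦ norm_nonneg _) fun j _ ↦ ?_)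
      (abs_nonneg _)
    refine (norm_sum_le _ _).trans (le_trans (le_of_eq ?_)
      (Real.sum_le_exp_of_nonneg (abs_nonneg (a j * w j)) N))
    refine Finset.sum_congr rfl fun n _ ↦ ?_
    rw [norm_div, norm_pow, norm_mul, Complex.norm_real, Complex.norm_I, mul_one,
      Complex.norm_natCast, Real.norm_eq_abs]
  · refine Tendsto.const_mul _ (tendsto_finsetProd _ fun j _ ↦ ?_)
    have := NormedSpace.expSeries_div_hasSum_exp (((a j * w j : ℝ) : ℂ) * Complex.I)
    rw [← Complex.exp_eq_exp_ℂ] at this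
    exact this.tendsto_sum_nat

/-- Completeness of the Hermite polynomials in `L²` of the standard Gaussian measure. -/
theorem ae_eq_zero_of_forall_integral_mul_hermiteProd_eq_zero
    (hf : MemLp f 2 (stdGaussianMeasure ι))
    (h0 : ∀ v, ∫ w, f w * hermiteProd v w ∂(stdGaussianMeasure ι) = 0) :
    f =ᵐ[stdGaussianMeasure ι] 0 := by
  classical
  have hfi : Integrable f (stdGaussianMeasure ι) := hf.integrable (by norm_num)
  have hp : AEMeasurable (fun w ↦ ENNReal.ofReal (f w)) (stdGaussianMeasure ι) :=
    hfi.aestronglyMeasurable.aemeasurable.ennreal_ofReal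
  have hn : AEMeasurable (fun w ↦ ENNReal.ofReal (-f w)) (stdGaussianMeasure ι) :=
    hfi.aestronglyMeasurable.aemeasurable.neg.ennreal_ofReal
  have hpf : IsFiniteMeasure ((stdGaussianMeasure ι).withDensity fun w ↦ ENNReal.ofReal (f w)) :=
    isFiniteMeasure_withDensity_ofReal hfi.2
  have hnf : IsFiniteMeasure ((stdGaussianMeasure ι).withDensity fun w ↦ ENNReal.ofReal (-f w)) :=
    isFiniteMeasure_withDensity_ofReal hfi.neg.2
  -- The positive and negative parts of `f` define finite measures whose characteristic functions
  -- differ by the vanishing Fourier integral, so the measures agree.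
  have heq : (stdGaussianMeasure ι).withDensity (fun w ↦ ENNReal.ofReal (f w))
      = (stdGaussianMeasure ι).withDensity fun w ↦ ENNReal.ofReal (-f w) := by
    refine Measure.ext_of_charFunDual (funext fun ℓ ↦ ?_)
    rw [charFunDual_apply, charFunDual_apply,
      integral_withDensity_eq_integral_toReal_smul₀ hp (by simp),
      integral_withDensity_eq_integral_toReal_smul₀ hn (by simp)]
    have hℓ : ∀ w : ι → ℝ, Complex.exp (ℓ w * Complex.I)
        = ∏ j, Complex.exp ((ℓ (Pi.single j 1) * w j : ℝ) * Complex.I) := by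
      intro w
      rw [← Complex.exp_sum, ← Finset.sum_mul, ← Complex.ofReal_sum]
      congr 3
      conv_lhs => rw [← Finset.univ_sum_single w, map_sum]
      refine Finset.sum_congr rfl fun j _ ↦ ?_
      rw [show Pi.single j (w j) = w j • (Pi.single j 1 : ι → ℝ) by
        rw [← Pi.single_smul, smul_eq_mul, mul_one], map_smul, smul_eq_mul, mul_comm]
    have hc : Continuous fun w : ι → ℝ ↦ Complex.exp (ℓ w * Complex.I) := by fun_prop
    have hi : ∀ g : (ι → ℝ) → ℝ, Integrable g (stdGaussianMeasure ι) →
        Integrable (fun w ↦ (ENNReal.ofReal (g w)).toReal • Complex.exp (ℓ w * Complex.I))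
          (stdGaussianMeasure ι) := by
      intro g hg
      have hg' : Integrable (fun w ↦ (ENNReal.ofReal (g w)).toReal) (stdGaussianMeasure ι) := by
        refine hg.mono hg.aestronglyMeasurable.aemeasurable.ennreal_ofReal.ennreal_toReal.aestronglyMeasurable
          (.of_forall fun w ↦ ?_)
        rw [ENNReal.toReal_ofReal', Real.norm_eq_abs, Real.norm_eq_abs, abs_of_nonneg (le_max_right _ _)]
        exact max_le (le_abs_self _) (abs_nonneg _)
      refine hg'.norm.mono (hg'.aestronglyMeasurable.smul hc.aestronglyMeasurable)
        (.of_forall fun w ↦ ?_)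
      rw [norm_smul, Complex.norm_exp_ofReal_mul_I, mul_one, norm_norm]
    rw [← sub_eq_zero, ← integral_sub (hi f hfi) (hi (fun w ↦ -f w) hfi.neg)]
    refine Eq.trans ?_ (integral_mul_cexp_eq_zero hf h0 fun j ↦ ℓ (Pi.single j 1))
    refine integral_congr_ae (.of_forall fun w ↦ ?_)
    simp only [← hℓ, ← sub_smul, ENNReal.toReal_ofReal']
    rw [show max (f w) 0 - max (-f w) 0 = f w by
      rcases le_total 0 (f w) with h | h
      · rw [max_eq_left h, max_eq_right (by linarith), sub_zero]
      · rw [max_eq_right h, max_eq_left (by linarith), zero_sub, neg_neg], Complex.real_smul]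
  have hae := (withDensity_eq_iff_of_sigmaFinite hp hn).1 heq
  filter_upwards [hae] with w hw
  rcases le_total 0 (f w) with h | h
  · rw [ENNReal.ofReal_of_nonpos (by linarith : -f w ≤ 0), ENNReal.ofReal_eq_zero] at hw
    exact le_antisymm hw h
  · rw [ENNReal.ofReal_of_nonpos h, eq_comm, ENNReal.ofReal_eq_zero] at hw
    exact le_antisymm h (neg_nonpos.1 hw)

theorem integral_hermiteProd_mul_hermiteProd_stdGaussianMeasure (u v : ι → ℕ) :
    ∫ w, hermiteProd u w * hermiteProd v w ∂(stdGaussianMeasure ι)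
      = if u = v then ∏ j, ((v j).factorial : ℝ) else 0 := by
  have h1 : ∀ k l : ℕ, ∫ x, (hermiteReal k).eval x * (hermiteReal l).eval x ∂(gaussianReal 0 1)
      = if k = l then (l.factorial : ℝ) else 0 := by
    intro k l
    have hlaw : HasGaussianLaw (fun x : ℝ ↦ (x, x)) (gaussianReal 0 1) :=
      (IsGaussian.hasGaussianLaw_id (μ := gaussianReal 0 1)).map_fun
        ((ContinuousLinearMap.id ℝ ℝ).prod (ContinuousLinearMap.id ℝ ℝ))
    have hvar : variance (fun x : ℝ ↦ x) (gaussianReal 0 1) = 1 := by simp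
    have := integral_hermite_mul_hermite hlaw (by simp) hvar (by simp) hvar k l
    rw [this, covariance_self (by fun_prop), hvar]
    split_ifs with h
    · simp [h]
    · rfl
  simp only [hermiteProd_eq, ← Finset.prod_mul_distrib, stdGaussianMeasure]
  rw [integral_fintype_prod_eq_prod (𝕜 := ℝ)
    (fun j x ↦ (hermiteReal (u j)).eval x * (hermiteReal (v j)).eval x)]
  simp only [h1]
  split_ifs with h
  · simp [h]
  · obtain ⟨j, hj⟩ := Function.ne_iff.1 h
    exact Finset.prod_eq_zero (Finset.mem_univ j) (if_neg hj)

/-- The norm `√v!` of the Hermite polynomial `e_v` in `L²` of the standard Gaussian measure. -/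
noncomputable def hermiteNorm (v : ι → ℕ) : ℝ := √(∏ j, ((v j).factorial : ℝ))

theorem prod_factorial_pos (v : ι → ℕ) : 0 < ∏ j, ((v j).factorial : ℝ) :=
  Finset.prod_pos fun j _ ↦ by positivity

theorem hermiteNorm_pos (v : ι → ℕ) : 0 < hermiteNorm v := Real.sqrt_pos.2 (prod_factorial_pos v)

theorem hermiteNorm_sq (v : ι → ℕ) : hermiteNorm v ^ 2 = ∏ j, ((v j).factorial : ℝ) :=
  Real.sq_sqrt (prod_factorial_pos v).le

theorem memLp_two_hermiteProd (v : ι → ℕ) : MemLp (hermiteProd v) 2 (stdGaussianMeasure ι) := by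
  simpa using memLp_hermiteProd v 2

/-- The normalized Hermite polynomials as elements of `L²`. -/
noncomputable def hermiteLp (v : ι → ℕ) : Lp ℝ 2 (stdGaussianMeasure ι) :=
  (hermiteNorm v)⁻¹ • (memLp_two_hermiteProd v).toLp (hermiteProd v)

theorem inner_toLp_hermiteProd (v : ι → ℕ) (g : Lp ℝ 2 (stdGaussianMeasure ι)) :
    inner ℝ ((memLp_two_hermiteProd v).toLp (hermiteProd v)) g = hermiteCoeff g v := by
  rw [L2.inner_def, hermiteCoeff]
  refine integral_congr_ae ?_
  filter_upwards [(memLp_two_hermiteProd v).coeFn_toLp] with w hw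
  rw [hw]
  simp

theorem hermiteCoeff_congr {g : (ι → ℝ) → ℝ} (h : f =ᵐ[stdGaussianMeasure ι] g) (v : ι → ℕ) :
    hermiteCoeff f v = hermiteCoeff g v := by
  refine integral_congr_ae ?_
  filter_upwards [h] with w hw
  rw [hw]

theorem orthonormal_hermiteLp : Orthonormal ℝ (hermiteLp (ι := ι)) := by
  classical
  rw [orthonormal_iff_ite]
  intro u v
  rw [hermiteLp, hermiteLp, real_inner_smul_left, real_inner_smul_right, inner_toLp_hermiteProd,
    hermiteCoeff_congr (memLp_two_hermiteProd v).coeFn_toLp, hermiteCoeff,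
    integral_hermiteProd_mul_hermiteProd_stdGaussianMeasure]
  rcases eq_or_ne u v with rfl | h
  · simp only [if_true, ← hermiteNorm_sq]
    field_simp [(hermiteNorm_pos u).ne']
  · simp [h, h.symm]

theorem orthogonal_span_hermiteLp :
    (Submodule.span ℝ (Set.range (hermiteLp (ι := ι))))ᗮ = ⊥ := by
  rw [Submodule.eq_bot_iff]
  intro g hg
  refine (Lp.eq_zero_iff_ae_eq_zero).2
    (ae_eq_zero_of_forall_integral_mul_hermiteProd_eq_zero (Lp.memLp g) fun v ↦ ?_)
  have h1 := (Submodule.mem_orthogonal _ _).1 hg _ (Submodule.subset_span ⟨v, rfl⟩)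
  rw [hermiteLp, real_inner_smul_left, inner_toLp_hermiteProd] at h1
  exact (mul_eq_zero.1 h1).resolve_left (inv_pos.2 (hermiteNorm_pos v)).ne'

/-- Finite Hermite expansions approximate in `L²`. -/
theorem exists_eLpNorm_sub_hermite_sum_le (hf : MemLp f 2 (stdGaussianMeasure ι))
    (s₀ : Finset (ι → ℕ)) {δ : ℝ} (hδ : 0 < δ) :
    ∃ s, s₀ ⊆ s ∧ eLpNorm (fun w ↦ f w - ∑ v ∈ s,
      hermiteCoeff f v / (∏ j, ((v j).factorial : ℝ)) * hermiteProd v w) 2 (stdGaussianMeasure ι)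
        ≤ ENNReal.ofReal δ := by
  classical
  set b := HilbertBasis.mkOfOrthogonalEqBot orthonormal_hermiteLp (orthogonal_span_hermiteLp (ι := ι))
  have hsum := b.hasSum_repr (hf.toLp f)
  -- Convergence is along the net of finite sets, so the approximating set may be required to
  -- contain `s₀`.
  have hev := (Metric.tendsto_nhds.1 hsum δ hδ).and (eventually_ge_atTop s₀)
  obtain ⟨s, hs, hs₀⟩ := hev.exists
  refine ⟨s, hs₀, ?_⟩
  have hterm : ∀ v, b.repr (hf.toLp f) v • b v
      = (hermiteCoeff f v / (∏ j, ((v j).factorial : ℝ))) •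
        (memLp_two_hermiteProd v).toLp (hermiteProd v) := by
    intro v
    rw [b.repr_apply_apply, HilbertBasis.coe_mkOfOrthogonalEqBot, hermiteLp, real_inner_smul_left,
      inner_toLp_hermiteProd, hermiteCoeff_congr hf.coeFn_toLp, smul_smul, ← hermiteNorm_sq]
    congr 1
    field_simp
  rw [dist_comm, dist_eq_norm] at hs
  simp only [hterm] at hs
  have hm : MemLp (fun w ↦ ∑ v ∈ s,
      hermiteCoeff f v / (∏ j, ((v j).factorial : ℝ)) * hermiteProd v w) 2 (stdGaussianMeasure ι) :=
    memLp_finsetSum s fun v _ ↦ (memLp_two_hermiteProd v).const_mul _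
  have hae : ⇑(hf.toLp f - ∑ v ∈ s, (hermiteCoeff f v / (∏ j, ((v j).factorial : ℝ))) •
      (memLp_two_hermiteProd v).toLp (hermiteProd v)) =ᵐ[stdGaussianMeasure ι] fun w ↦ f w -
        ∑ v ∈ s, hermiteCoeff f v / (∏ j, ((v j).factorial : ℝ)) * hermiteProd v w := by
    have h1 : ∀ᵐ w ∂(stdGaussianMeasure ι), ∀ v ∈ s,
        ((hermiteCoeff f v / (∏ j, ((v j).factorial : ℝ))) •
          (memLp_two_hermiteProd v).toLp (hermiteProd v) : Lp ℝ 2 (stdGaussianMeasure ι)) w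
        = hermiteCoeff f v / (∏ j, ((v j).factorial : ℝ)) * hermiteProd v w := by
      refine (Finset.eventually_all s).2 fun v _ ↦ ?_
      filter_upwards [Lp.coeFn_smul (hermiteCoeff f v / (∏ j, ((v j).factorial : ℝ)))
        ((memLp_two_hermiteProd v).toLp (hermiteProd v)),
        (memLp_two_hermiteProd v).coeFn_toLp] with w h2 h3
      rw [h2, Pi.smul_apply, h3, smul_eq_mul]
    filter_upwards [Lp.coeFn_sub (hf.toLp f) (∑ v ∈ s,
      (hermiteCoeff f v / (∏ j, ((v j).factorial : ℝ))) •
        (memLp_two_hermiteProd v).toLp (hermiteProd v)), hf.coeFn_toLp,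
      Lp.coeFn_finsetSum s fun v ↦ (hermiteCoeff f v / (∏ j, ((v j).factorial : ℝ))) •
        (memLp_two_hermiteProd v).toLp (hermiteProd v), h1] with w h2 h3 h4 h5
    rw [h2, Pi.sub_apply, h3, h4]
    simp only [Finset.sum_apply]
    rw [Finset.sum_congr rfl h5]
  rw [Lp.norm_def, eLpNorm_congr_ae hae] at hs
  exact (ENNReal.le_ofReal_iff_toReal_le (hf.sub hm).eLpNorm_ne_top hδ.le).2 hs.le

/-- Bessel's inequality. Its independence of `s` is what lets the remainder be estimated before the
expansion is exhausted. -/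
theorem sum_hermiteCoeff_sq_le (hf : MemLp f 2 (stdGaussianMeasure ι)) (s : Finset (ι → ℕ)) :
    ∑ v ∈ s, hermiteCoeff f v ^ 2 / (∏ j, ((v j).factorial : ℝ)) ≤ ‖hf.toLp f‖ ^ 2 := by
  refine le_trans (le_of_eq (Finset.sum_congr rfl fun v _ ↦ ?_))
    (orthonormal_hermiteLp.sum_inner_products_le (hf.toLp f) (s := s))
  rw [hermiteLp, real_inner_smul_left, inner_toLp_hermiteProd, hermiteCoeff_congr hf.coeFn_toLp,
    ← hermiteNorm_sq, Real.norm_eq_abs, sq_abs]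
  field_simp

end Completeness

/-! ### Second moments of functionals of the field -/

section Field

open scoped NNReal ENNReal

variable {d : ℕ} {ι Ω : Type*} [Fintype ι] [MeasurableSpace Ω] {P : Measure Ω}
  {η : ι → EuclideanSpace ℝ (Fin d) → Ω → ℝ} {e : ι → ℝ} {L : ι → ℝ → ℝ}

/-- Independence of the components factorizes the expectation, and a single index mismatch makes one
factor vanish. -/
theorem integral_hermiteProd_mul_hermiteProd {X Y : ι → Ω → ℝ}
    (hind : iIndepFun (fun j ω ↦ (X j ω, Y j ω)) P)
    (hXY : ∀ j, HasGaussianLaw (fun ω ↦ (X j ω, Y j ω)) P)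
    (hX0 : ∀ j, ∫ ω, X j ω ∂P = 0) (hX1 : ∀ j, variance (X j) P = 1)
    (hY0 : ∀ j, ∫ ω, Y j ω ∂P = 0) (hY1 : ∀ j, variance (Y j) P = 1) (u v : ι → ℕ) :
    ∫ ω, hermiteProd u (fun j ↦ X j ω) * hermiteProd v (fun j ↦ Y j ω) ∂P
      = if u = v then ∏ j, ((v j).factorial : ℝ) * covariance (X j) (Y j) P ^ v j else 0 := by
  simp only [hermiteProd_eq, ← Finset.prod_mul_distrib]
  have hc : ∀ j, Continuous fun z : ℝ × ℝ ↦
      (hermiteReal (u j)).eval z.1 * (hermiteReal (v j)).eval z.2 := fun j ↦ by fun_prop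
  rw [hind.integral_fun_prod_comp
    (f := fun j z ↦ (hermiteReal (u j)).eval z.1 * (hermiteReal (v j)).eval z.2)
    (fun j ↦ (hXY j).aemeasurable) fun j ↦ (hc j).aestronglyMeasurable]
  simp only [fun j ↦ integral_hermite_mul_hermite (hXY j) (hX0 j) (hX1 j) (hY0 j) (hY1 j)]
  split_ifs with h
  · simp [h]
  · obtain ⟨j, hj⟩ := Function.ne_iff.1 h
    exact Finset.prod_eq_zero (Finset.mem_univ j) (if_neg hj)

namespace IsGaussianVectorField

theorem measurable_apply (hη : IsGaussianVectorField P η e L) (j : ι)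
    (x : EuclideanSpace ℝ (Fin d)) : Measurable (η j x) :=
  (hη.measurable j).comp measurable_prodMk_left

theorem hasGaussianLaw_pair (hη : IsGaussianVectorField P η e L) (j : ι)
    (x y : EuclideanSpace ℝ (Fin d)) : HasGaussianLaw (fun ω ↦ (η j x ω, η j y ω)) P :=
  hη.gaussian.hasGaussianLaw_prodMk (s := (j, x)) (t := (j, y))

theorem memLp_two (hη : IsGaussianVectorField P η e L) (j : ι)
    (x : EuclideanSpace ℝ (Fin d)) : MemLp (η j x) 2 P :=
  (hη.hasGaussianLaw_pair j x x).fst.memLp_two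

theorem indep_pair (hη : IsGaussianVectorField P η e L) (x y : EuclideanSpace ℝ (Fin d)) :
    iIndepFun (fun j ω ↦ (η j x ω, η j y ω)) P :=
  hη.indep.comp (fun _ f ↦ (f x, f y)) fun _ ↦ by fun_prop

theorem map_eq (hη : IsGaussianVectorField P η e L) (x : EuclideanSpace ℝ (Fin d)) :
    P.map (fun ω j ↦ η j x ω) = stdGaussianMeasure ι := by
  have h1 : iIndepFun (fun j ω ↦ η j x ω) P :=
    hη.indep.comp (fun _ f ↦ f x) fun _ ↦ by fun_prop
  rw [h1.map_fun_eq_pi_map fun j ↦ (hη.measurable_apply j x).aemeasurable, stdGaussianMeasure]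
  congr 1
  funext j
  rw [(hη.hasGaussianLaw_pair j x x).fst.map_eq_gaussianReal, hη.mean_zero, hη.variance_one]
  simp

theorem covariance_self_eq_one (hη : IsGaussianVectorField P η e L) (j : ι)
    (x : EuclideanSpace ℝ (Fin d)) : covariance (η j x) (η j x) P = 1 := by
  rw [covariance_self (hη.measurable_apply j x).aemeasurable, hη.variance_one]

theorem covariance_nonneg (hη : IsGaussianVectorField P η e L) (hL : ∀ j, SlowlyVarying (L j))
    (j : ι) (x y : EuclideanSpace ℝ (Fin d)) : 0 ≤ covariance (η j x) (η j y) P := by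
  rcases eq_or_ne x y with rfl | h
  · rw [hη.covariance_self_eq_one]
    exact zero_le_one
  · rw [hη.covariance_eq j x y h]
    exact mul_nonneg (Real.rpow_nonneg (norm_nonneg _) _)
      ((hL j).pos _ (norm_pos_iff.2 (sub_ne_zero.2 h))).le

theorem covariance_eq_integral (hη : IsGaussianVectorField P η e L) [IsProbabilityMeasure P] (j : ι)
    (x y : EuclideanSpace ℝ (Fin d)) :
    covariance (η j x) (η j y) P = ∫ ω, η j x ω * η j y ω ∂P := by
  rw [covariance_eq_sub (hη.memLp_two j x) (hη.memLp_two j y), hη.mean_zero, zero_mul, sub_zero]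
  rfl

theorem integral_sq (hη : IsGaussianVectorField P η e L) [IsProbabilityMeasure P] (j : ι)
    (x : EuclideanSpace ℝ (Fin d)) : ∫ ω, η j x ω * η j x ω ∂P = 1 := by
  rw [← hη.covariance_eq_integral, hη.covariance_self_eq_one]

theorem covariance_le_one (hη : IsGaussianVectorField P η e L) [IsProbabilityMeasure P] (j : ι)
    (x y : EuclideanSpace ℝ (Fin d)) : covariance (η j x) (η j y) P ≤ 1 := by
  have hi : ∀ x y, Integrable (fun ω ↦ η j x ω * η j y ω) P := fun x y ↦
    (hη.memLp_two j x).integrable_mul (hη.memLp_two j y)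
  rw [hη.covariance_eq_integral]
  calc ∫ ω, η j x ω * η j y ω ∂P
      ≤ ∫ ω, (η j x ω * η j x ω + η j y ω * η j y ω) / 2 ∂P :=
        integral_mono (hi x y) (((hi x x).add (hi y y)).div_const 2) fun ω ↦ by
          simp only
          nlinarith [sq_nonneg (η j x ω - η j y ω)]
    _ = 1 := by
        rw [integral_div, integral_add (hi x x) (hi y y), hη.integral_sq, hη.integral_sq]
        norm_num

theorem measurable_covariance (hη : IsGaussianVectorField P η e L) [IsProbabilityMeasure P]
    (j : ι) :
    Measurable fun z : EuclideanSpace ℝ (Fin d) × EuclideanSpace ℝ (Fin d) ↦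
      covariance (η j z.1) (η j z.2) P := by
  simp only [hη.covariance_eq_integral]
  have h1 : Measurable fun q : (EuclideanSpace ℝ (Fin d) × EuclideanSpace ℝ (Fin d)) × Ω ↦
      η j q.1.1 q.2 * η j q.1.2 q.2 :=
    ((hη.measurable j).comp ((measurable_fst.comp measurable_fst).prodMk measurable_snd)).mul
      ((hη.measurable j).comp ((measurable_snd.comp measurable_fst).prodMk measurable_snd))
  exact (h1.stronglyMeasurable.integral_prod_right (ν := P)).measurable

end IsGaussianVectorField

/-- The covariance of `e_v(η(x))` and `e_v(η(y))`, divided by `v!`. -/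
noncomputable def covProd (P : Measure Ω) (η : ι → EuclideanSpace ℝ (Fin d) → Ω → ℝ) (v : ι → ℕ)
    (z : EuclideanSpace ℝ (Fin d) × EuclideanSpace ℝ (Fin d)) : ℝ :=
  ∏ j, covariance (η j z.1) (η j z.2) P ^ v j

namespace IsGaussianVectorField

theorem covProd_nonneg (hη : IsGaussianVectorField P η e L) (hL : ∀ j, SlowlyVarying (L j))
    (v : ι → ℕ) (z : EuclideanSpace ℝ (Fin d) × EuclideanSpace ℝ (Fin d)) : 0 ≤ covProd P η v z :=
  Finset.prod_nonneg fun j _ ↦ pow_nonneg (hη.covariance_nonneg hL j _ _) _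

/-- Each correlation lies in `[0,1]`, so larger powers are smaller. This monotonicity reduces
uniform estimates over multi-indices to minimal ones. -/
theorem covProd_anti (hη : IsGaussianVectorField P η e L) [IsProbabilityMeasure P]
    (hL : ∀ j, SlowlyVarying (L j)) {u v : ι → ℕ} (huv : u ≤ v)
    (z : EuclideanSpace ℝ (Fin d) × EuclideanSpace ℝ (Fin d)) :
    covProd P η v z ≤ covProd P η u z :=
  Finset.prod_le_prod (fun j _ ↦ pow_nonneg (hη.covariance_nonneg hL j _ _) _) fun j _ ↦
    pow_le_pow_of_le_one (hη.covariance_nonneg hL j _ _) (hη.covariance_le_one j _ _) (huv j)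

theorem covProd_le_one (hη : IsGaussianVectorField P η e L) [IsProbabilityMeasure P]
    (hL : ∀ j, SlowlyVarying (L j)) (v : ι → ℕ)
    (z : EuclideanSpace ℝ (Fin d) × EuclideanSpace ℝ (Fin d)) : covProd P η v z ≤ 1 := by
  have := hη.covProd_anti hL (Pi.le_def.2 fun j ↦ Nat.zero_le (v j) : (0 : ι → ℕ) ≤ v) z
  simpa [covProd] using this

theorem covProd_eq (hη : IsGaussianVectorField P η e L) (v : ι → ℕ)
    {z : EuclideanSpace ℝ (Fin d) × EuclideanSpace ℝ (Fin d)} (hz : z.1 ≠ z.2) :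
    covProd P η v z
      = ‖z.1 - z.2‖ ^ (-exponentSum e v) * ∏ j, L j ‖z.1 - z.2‖ ^ v j := by
  have hpos : 0 < ‖z.1 - z.2‖ := norm_pos_iff.2 (sub_ne_zero.2 hz)
  simp only [covProd, fun j ↦ hη.covariance_eq j z.1 z.2 hz, mul_pow, Finset.prod_mul_distrib]
  congr 1
  rw [exponentSum, ← Finset.sum_neg_distrib, Real.rpow_sum_of_pos hpos]
  refine Finset.prod_congr rfl fun j _ ↦ ?_
  rw [← Real.rpow_natCast, ← Real.rpow_mul hpos.le, neg_mul]

theorem measurable_covProd (hη : IsGaussianVectorField P η e L) [IsProbabilityMeasure P]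
    (v : ι → ℕ) : Measurable (covProd P η v) :=
  Finset.measurable_fun_prod _ fun j _ ↦ (hη.measurable_covariance j).pow_const _

theorem integrable_covProd (hη : IsGaussianVectorField P η e L) [IsProbabilityMeasure P]
    (hL : ∀ j, SlowlyVarying (L j)) (v : ι → ℕ)
    (m : Measure (EuclideanSpace ℝ (Fin d) × EuclideanSpace ℝ (Fin d))) [IsFiniteMeasure m] :
    Integrable (covProd P η v) m := by
  refine (integrable_const (1 : ℝ)).mono' (hη.measurable_covProd v).aestronglyMeasurable
    (.of_forall fun z ↦ ?_)
  rw [Real.norm_eq_abs, abs_of_nonneg (hη.covProd_nonneg hL v z)]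
  exact hη.covProd_le_one hL v z

theorem integral_hermiteProd_pair (hη : IsGaussianVectorField P η e L) (u v : ι → ℕ)
    (x y : EuclideanSpace ℝ (Fin d)) :
    ∫ ω, hermiteProd u (fun j ↦ η j x ω) * hermiteProd v (fun j ↦ η j y ω) ∂P
      = if u = v then (∏ j, ((v j).factorial : ℝ)) * covProd P η v (x, y) else 0 := by
  rw [integral_hermiteProd_mul_hermiteProd (hη.indep_pair x y)
    (fun j ↦ hη.hasGaussianLaw_pair j x y) (fun j ↦ hη.mean_zero j x)
    (fun j ↦ hη.variance_one j x) (fun j ↦ hη.mean_zero j y) (fun j ↦ hη.variance_one j y),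
    Finset.prod_mul_distrib]
  rfl

section Integrals

variable {F : (ι → ℝ) → ℝ}

theorem measurable_uncurry (hη : IsGaussianVectorField P η e L) {S : Type*} [MeasurableSpace S]
    {a : S → EuclideanSpace ℝ (Fin d)} (ha : Measurable a) :
    Measurable fun (z : S × Ω) j ↦ η j (a z.1) z.2 :=
  measurable_pi_lambda _ fun j ↦
    (hη.measurable j).comp ((ha.comp measurable_fst).prodMk measurable_snd)

/-- The law of the field at a point does not depend on the point. Consequently an `L²` function,
known only up to Gaussian null sets, may be composed with the field over space and `Ω` jointly. The
general map `a` covers both projections of a pair of points. -/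
theorem map_uncurry (hη : IsGaussianVectorField P η e L) [IsProbabilityMeasure P]
    {S : Type*} [MeasurableSpace S] (m : Measure S) [IsFiniteMeasure m]
    {a : S → EuclideanSpace ℝ (Fin d)} (ha : Measurable a) :
    (m.prod P).map (fun z j ↦ η j (a z.1) z.2) = m Set.univ • stdGaussianMeasure ι := by
  ext s hs
  rw [Measure.map_apply (hη.measurable_uncurry ha) hs,
    Measure.prod_apply (hη.measurable_uncurry ha hs)]
  have h1 : ∀ x : S, P (Prod.mk x ⁻¹' ((fun (z : S × Ω) j ↦ η j (a z.1) z.2) ⁻¹' s))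
      = stdGaussianMeasure ι s := by
    intro x
    rw [← hη.map_eq (a x), Measure.map_apply
      (measurable_pi_lambda _ fun j ↦ hη.measurable_apply j (a x)) hs]
    rfl
  simp [h1, mul_comm]

theorem memLp_comp (hη : IsGaussianVectorField P η e L) (hF : MemLp F 2 (stdGaussianMeasure ι))
    (x : EuclideanSpace ℝ (Fin d)) : MemLp (fun ω ↦ F fun j ↦ η j x ω) 2 P := by
  rw [← hη.map_eq x] at hF
  exact hF.comp_of_map (measurable_pi_lambda _ fun j ↦ hη.measurable_apply j x).aemeasurable

theorem integral_comp (hη : IsGaussianVectorField P η e L)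
    (hF : AEStronglyMeasurable F (stdGaussianMeasure ι)) (x : EuclideanSpace ℝ (Fin d)) :
    ∫ ω, F (fun j ↦ η j x ω) ∂P = ∫ w, F w ∂(stdGaussianMeasure ι) := by
  rw [← hη.map_eq x] at hF ⊢
  rw [integral_map (measurable_pi_lambda _ fun j ↦ hη.measurable_apply j x).aemeasurable hF]

theorem memLp_comp_uncurry (hη : IsGaussianVectorField P η e L) [IsProbabilityMeasure P]
    (hF : MemLp F 2 (stdGaussianMeasure ι)) {S : Type*} [MeasurableSpace S] (m : Measure S)
    [IsFiniteMeasure m] {a : S → EuclideanSpace ℝ (Fin d)} (ha : Measurable a) :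
    MemLp (fun z : S × Ω ↦ F fun j ↦ η j (a z.1) z.2) 2 (m.prod P) := by
  have h1 : MemLp F 2 (m Set.univ • stdGaussianMeasure ι) :=
    hF.smul_measure (measure_ne_top m _)
  rw [← hη.map_uncurry m ha] at h1
  exact h1.comp_of_map (hη.measurable_uncurry ha).aemeasurable

variable (m : Measure (EuclideanSpace ℝ (Fin d))) [IsFiniteMeasure m] [IsProbabilityMeasure P]

theorem integrable_comp_uncurry (hη : IsGaussianVectorField P η e L)
    (hF : MemLp F 2 (stdGaussianMeasure ι)) :
    Integrable (fun z : EuclideanSpace ℝ (Fin d) × Ω ↦ F fun j ↦ η j z.1 z.2) (m.prod P) :=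
  (hη.memLp_comp_uncurry hF m measurable_id).integrable (by norm_num)

theorem ae_integrable (hη : IsGaussianVectorField P η e L)
    (hF : MemLp F 2 (stdGaussianMeasure ι)) :
    ∀ᵐ ω ∂P, Integrable (fun x ↦ F fun j ↦ η j x ω) m :=
  (hη.integrable_comp_uncurry m hF).prod_left_ae

theorem integral_integral_comp (hη : IsGaussianVectorField P η e L)
    (hF : MemLp F 2 (stdGaussianMeasure ι)) :
    ∫ ω, ∫ x, F (fun j ↦ η j x ω) ∂m ∂P = m.real Set.univ * ∫ w, F w ∂(stdGaussianMeasure ι) := by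
  rw [integral_integral_swap (f := fun ω x ↦ F fun j ↦ η j x ω)
    (hη.integrable_comp_uncurry m hF).swap]
  simp [hη.integral_comp hF.aestronglyMeasurable]

theorem integrable_mul_uncurry (hη : IsGaussianVectorField P η e L)
    (hF : MemLp F 2 (stdGaussianMeasure ι)) :
    Integrable (fun z : (EuclideanSpace ℝ (Fin d) × EuclideanSpace ℝ (Fin d)) × Ω ↦
      (F fun j ↦ η j z.1.1 z.2) * F fun j ↦ η j z.1.2 z.2) ((m.prod m).prod P) :=
  (hη.memLp_comp_uncurry hF (m.prod m) measurable_fst).integrable_mul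
    (hη.memLp_comp_uncurry hF (m.prod m) measurable_snd)

theorem memLp_integral_comp (hη : IsGaussianVectorField P η e L)
    (hF : MemLp F 2 (stdGaussianMeasure ι)) :
    MemLp (fun ω ↦ ∫ x, F (fun j ↦ η j x ω) ∂m) 2 P := by
  have h1 : AEStronglyMeasurable (fun ω ↦ ∫ x, F (fun j ↦ η j x ω) ∂m) P :=
    (hη.integrable_comp_uncurry m hF).swap.aestronglyMeasurable.integral_prod_right'
  refine (memLp_two_iff_integrable_sq h1).2 ?_
  refine (hη.integrable_mul_uncurry m hF).integral_prod_right.congr (.of_forall fun ω ↦ ?_)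
  simp only
  rw [sq]
  exact integral_prod_mul (fun x ↦ F fun j ↦ η j x ω) fun x ↦ F fun j ↦ η j x ω

theorem integral_sq_integral_comp (hη : IsGaussianVectorField P η e L)
    (hF : MemLp F 2 (stdGaussianMeasure ι)) :
    ∫ ω, (∫ x, F (fun j ↦ η j x ω) ∂m) ^ 2 ∂P
      = ∫ z, ∫ ω, (F fun j ↦ η j z.1 ω) * (F fun j ↦ η j z.2 ω) ∂P ∂(m.prod m) := by
  refine Eq.trans ?_ (integral_integral_swap
    (f := fun (z : EuclideanSpace ℝ (Fin d) × EuclideanSpace ℝ (Fin d)) ω ↦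
      (F fun j ↦ η j z.1 ω) * F fun j ↦ η j z.2 ω) (hη.integrable_mul_uncurry m hF)).symm
  refine integral_congr_ae (.of_forall fun ω ↦ ?_)
  simp only
  rw [sq]
  exact (integral_prod_mul (fun x ↦ F fun j ↦ η j x ω) fun x ↦ F fun j ↦ η j x ω).symm

/-- From `ab ≤ (a² + b²)/2` and the common one-point law. The bound is crude in the window size but
suffices for the tail of the expansion, which can be made small for each fixed window. -/
theorem integral_sq_integral_comp_le (hη : IsGaussianVectorField P η e L)
    (hF : MemLp F 2 (stdGaussianMeasure ι)) :
    ∫ ω, (∫ x, F (fun j ↦ η j x ω) ∂m) ^ 2 ∂P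
      ≤ m.real Set.univ ^ 2 * ∫ w, F w ^ 2 ∂(stdGaussianMeasure ι) := by
  have hsq : ∀ x, ∫ ω, F (fun j ↦ η j x ω) ^ 2 ∂P = ∫ w, F w ^ 2 ∂(stdGaussianMeasure ι) :=
    hη.integral_comp (F := fun w ↦ F w ^ 2) (hF.aestronglyMeasurable.pow 2)
  have hi : ∀ x, Integrable (fun ω ↦ F (fun j ↦ η j x ω) ^ 2) P := fun x ↦
    (hη.memLp_comp hF x).integrable_sq
  rw [hη.integral_sq_integral_comp m hF]
  calc ∫ z, ∫ ω, (F fun j ↦ η j z.1 ω) * (F fun j ↦ η j z.2 ω) ∂P ∂(m.prod m)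
      ≤ ∫ _, ∫ w, F w ^ 2 ∂(stdGaussianMeasure ι) ∂(m.prod m) := by
        refine integral_mono (hη.integrable_mul_uncurry m hF).integral_prod_left
          (integrable_const _) fun z ↦ ?_
        calc ∫ ω, (F fun j ↦ η j z.1 ω) * (F fun j ↦ η j z.2 ω) ∂P
            ≤ ∫ ω, (F (fun j ↦ η j z.1 ω) ^ 2 + F (fun j ↦ η j z.2 ω) ^ 2) / 2 ∂P :=
              integral_mono ((hη.memLp_comp hF z.1).integrable_mul (hη.memLp_comp hF z.2))
                (((hi z.1).add (hi z.2)).div_const 2) fun ω ↦ by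
                  simp only
                  nlinarith [sq_nonneg ((F fun j ↦ η j z.1 ω) - F fun j ↦ η j z.2 ω)]
          _ = ∫ w, F w ^ 2 ∂(stdGaussianMeasure ι) := by
              rw [integral_div, integral_add (hi _) (hi _), hsq, hsq]
              ring
    _ = m.real Set.univ ^ 2 * ∫ w, F w ^ 2 ∂(stdGaussianMeasure ι) := by
        rw [integral_const, smul_eq_mul, ← Set.univ_prod_univ, measureReal_prod_prod, sq]

theorem memLp_hermite_sum (s : Finset (ι → ℕ)) (c : (ι → ℕ) → ℝ) :
    MemLp (fun w ↦ ∑ v ∈ s, c v * hermiteProd v w) 2 (stdGaussianMeasure ι) :=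
  memLp_finsetSum s fun v _ ↦ (memLp_two_hermiteProd v).const_mul _

theorem integral_sq_integral_hermite_sum (hη : IsGaussianVectorField P η e L)
    (hL : ∀ j, SlowlyVarying (L j)) (s : Finset (ι → ℕ)) (c : (ι → ℕ) → ℝ) :
    ∫ ω, (∫ x, ∑ v ∈ s, c v * hermiteProd v (fun j ↦ η j x ω) ∂m) ^ 2 ∂P
      = ∑ v ∈ s, c v ^ 2 * (∏ j, ((v j).factorial : ℝ)) * ∫ z, covProd P η v z ∂(m.prod m) := by
  rw [hη.integral_sq_integral_comp m (memLp_hermite_sum s c)]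
  have h1 : ∀ z : EuclideanSpace ℝ (Fin d) × EuclideanSpace ℝ (Fin d),
      ∫ ω, (∑ v ∈ s, c v * hermiteProd v fun j ↦ η j z.1 ω) *
        (∑ v ∈ s, c v * hermiteProd v fun j ↦ η j z.2 ω) ∂P
      = ∑ v ∈ s, c v ^ 2 * (∏ j, ((v j).factorial : ℝ)) * covProd P η v z := by
    intro z
    have hi : ∀ u v : ι → ℕ, Integrable (fun ω ↦ (c u * hermiteProd u fun j ↦ η j z.1 ω) *
        (c v * hermiteProd v fun j ↦ η j z.2 ω)) P := fun u v ↦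
      ((hη.memLp_comp (memLp_two_hermiteProd u) z.1).const_mul _).integrable_mul
        ((hη.memLp_comp (memLp_two_hermiteProd v) z.2).const_mul _)
    simp only [Finset.sum_mul_sum]
    rw [integral_finsetSum _ fun u _ ↦ integrable_finsetSum _ fun v _ ↦ hi u v]
    refine Finset.sum_congr rfl fun u hu ↦ ?_
    rw [integral_finsetSum _ fun v _ ↦ hi u v, Finset.sum_eq_single u]
    · simp only [mul_mul_mul_comm (c u), integral_const_mul, hη.integral_hermiteProd_pair, if_true]
      ring
    · intro v _ hv
      simp only [mul_mul_mul_comm (c u), integral_const_mul, hη.integral_hermiteProd_pair,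
        if_neg hv.symm, mul_zero]
    · exact fun h ↦ absurd hu h
  simp only [h1]
  rw [integral_finsetSum _ fun v _ ↦ (hη.integrable_covProd hL v _).const_mul _]
  simp only [integral_const_mul]

end Integrals

end IsGaussianVectorField

end Field

/-! ### Double integrals over growing windows -/

section Window

variable {d : ℕ} {Δ : Set (EuclideanSpace ℝ (Fin d))}

/-- Pairs of points at distance at most `R`. -/
def nearPairs (d : ℕ) (R : ℝ) : Set (EuclideanSpace ℝ (Fin d) × EuclideanSpace ℝ (Fin d)) :=
  {z | ‖z.1 - z.2‖ ≤ R}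

theorem measurableSet_nearPairs (R : ℝ) : MeasurableSet (nearPairs d R) :=
  measurableSet_le (by fun_prop) measurable_const

/-- Every slice of the near pairs lies in a ball of radius `R`. For `A = Δ(r)` this gives order
`r^d`, against `r^{2d}` for all pairs. -/
theorem measureReal_prod_nearPairs_le (A : Set (EuclideanSpace ℝ (Fin d)))
    [IsFiniteMeasure (volume.restrict A)] (R : ℝ) :
    ((volume.restrict A).prod (volume.restrict A)).real (nearPairs d R)
      ≤ volume.real A * volume.real (Metric.closedBall (0 : EuclideanSpace ℝ (Fin d)) R) := by
  have hA : volume A ≠ ⊤ := by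
    simpa using measure_ne_top (volume.restrict A) Set.univ
  have hB : volume (Metric.closedBall (0 : EuclideanSpace ℝ (Fin d)) R) ≠ ⊤ :=
    (isCompact_closedBall _ R).measure_lt_top.ne
  have h1 : ((volume.restrict A).prod (volume.restrict A)) (nearPairs d R)
      ≤ volume (Metric.closedBall (0 : EuclideanSpace ℝ (Fin d)) R) * volume A := by
    rw [Measure.prod_apply (measurableSet_nearPairs R)]
    calc ∫⁻ x, volume.restrict A (Prod.mk x ⁻¹' nearPairs d R) ∂(volume.restrict A)
        ≤ ∫⁻ _, volume (Metric.closedBall (0 : EuclideanSpace ℝ (Fin d)) R)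
            ∂(volume.restrict A) := by
          refine lintegral_mono fun x ↦ ?_
          refine (Measure.restrict_apply_le _ _).trans ?_
          rw [← Measure.addHaar_closedBall_center volume x R]
          refine measure_mono fun y hy ↦ ?_
          rw [Metric.mem_closedBall, dist_comm, dist_eq_norm]
          exact hy
      _ = _ := by simp
  rw [mul_comm, Measure.real, Measure.real, Measure.real, ← ENNReal.toReal_mul]
  exact ENNReal.toReal_mono (ENNReal.mul_ne_top hB hA) h1

namespace IsWindow

theorem isCompact_smul (hΔ : IsWindow Δ) (r : ℝ) : IsCompact (r • Δ) := hΔ.isCompact.smul r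

theorem isFiniteMeasure_restrict (hΔ : IsWindow Δ) (r : ℝ) :
    IsFiniteMeasure (volume.restrict (r • Δ)) :=
  ⟨by simpa using (hΔ.isCompact_smul r).measure_lt_top (μ := volume)⟩

theorem volume_real_pos (hΔ : IsWindow Δ) : 0 < volume.real Δ :=
  ENNReal.toReal_pos hΔ.volume_pos.ne' hΔ.isCompact.measure_lt_top.ne

theorem volume_real_smul {r : ℝ} (hr : 0 ≤ r) :
    volume.real (r • Δ) = r ^ d * volume.real Δ := by
  rw [Measure.real, Measure.addHaar_smul_of_nonneg _ hr, finrank_euclideanSpace_fin,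
    ENNReal.toReal_mul, ENNReal.toReal_ofReal (by positivity), Measure.real]

theorem exists_norm_sub_le (hΔ : IsWindow Δ) :
    ∃ D : ℝ, 0 < D ∧ ∀ r : ℝ, 0 ≤ r → ∀ x ∈ r • Δ, ∀ y ∈ r • Δ, ‖x - y‖ ≤ r * D := by
  obtain ⟨D, hD⟩ := Metric.isBounded_iff.1 hΔ.isCompact.isBounded
  refine ⟨max D 1, by positivity, ?_⟩
  rintro r hr _ ⟨x, hx, rfl⟩ _ ⟨y, hy, rfl⟩
  simp only
  rw [← smul_sub, norm_smul, Real.norm_of_nonneg hr]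
  have := hD hx hy
  rw [dist_eq_norm] at this
  exact mul_le_mul_of_nonneg_left (this.trans (le_max_left _ _)) hr

variable {b b' : EuclideanSpace ℝ (Fin d) × EuclideanSpace ℝ (Fin d) → ℝ}

/-- The integral over `Δ(r) × Δ(r)` of a kernel which decays more slowly than `ρ ^ (-d)` grows
faster than `r ^ d`. -/
theorem eventually_mul_pow_le_integral (hΔ : IsWindow Δ) (hd : d ≠ 0) (hbm : Measurable b)
    (hb0 : ∀ z, 0 ≤ b z) (hb1 : ∀ z, b z ≤ 1) {f : ℝ → ℝ}
    (hbf : ∀ z, z.1 ≠ z.2 → b z = f ‖z.1 - z.2‖) (hf : Tendsto (fun ρ ↦ ρ ^ d * f ρ) atTop atTop)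
    (M : ℝ) :
    ∀ᶠ r : ℝ in atTop, M * r ^ d
      ≤ ∫ z, b z ∂((volume.restrict (r • Δ)).prod (volume.restrict (r • Δ))) := by
  obtain ⟨D, hD0, hD⟩ := hΔ.exists_norm_sub_le
  have hV := hΔ.volume_real_pos
  set V := volume.real Δ
  -- Chosen so that `K / (r * D) ^ d`, a lower bound for the kernel at far pairs, times half the
  -- squared volume of `Δ(r)` equals `|M| * r ^ d`.
  set K : ℝ := 2 * D ^ d * |M| / V ^ 2 with hK
  have hK0 : 0 ≤ K := by positivity
  obtain ⟨R, hR⟩ := eventually_atTop.1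
    ((hf.eventually (eventually_ge_atTop K)).and (eventually_gt_atTop (0 : ℝ)))
  set B := volume.real (Metric.closedBall (0 : EuclideanSpace ℝ (Fin d)) R)
  have hpow : Tendsto (fun r : ℝ ↦ r ^ d * V) atTop atTop :=
    (tendsto_pow_atTop hd).atTop_mul_const hV
  filter_upwards [hpow.eventually (eventually_ge_atTop (2 * B)), eventually_gt_atTop 0] with r hr hr0
  have hfin := hΔ.isFiniteMeasure_restrict r
  set m := volume.restrict (r • Δ) with hm
  have hmu : m.real Set.univ = r ^ d * V := by
    rw [hm, measureReal_restrict_apply MeasurableSet.univ, Set.univ_inter, volume_real_smul hr0.le]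
  have hnear := measureReal_prod_nearPairs_le (r • Δ) R
  rw [volume_real_smul hr0.le, ← hm] at hnear
  -- Once the volume of `Δ(r)` is at least `2 * B`, near pairs occupy at most half of `Δ(r) × Δ(r)`.
  have hfar : (r ^ d * V) ^ 2 / 2 ≤ (m.prod m).real (nearPairs d R)ᶜ := by
    rw [measureReal_compl (measurableSet_nearPairs R), ← Set.univ_prod_univ,
      measureReal_prod_prod, hmu]
    have : 0 < r ^ d * V := by positivity
    nlinarith
  have hint : Integrable b (m.prod m) :=
    (integrable_const (1 : ℝ)).mono' hbm.aestronglyMeasurable (.of_forall fun z ↦ by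
      rw [Real.norm_eq_abs, abs_of_nonneg (hb0 z)]
      exact hb1 z)
  have hmem : ∀ᵐ z ∂(m.prod m), z.1 ∈ r • Δ ∧ z.2 ∈ r • Δ := by
    have h1 : ∀ᵐ x ∂m, x ∈ r • Δ := ae_restrict_mem (hΔ.isCompact_smul r).measurableSet
    filter_upwards [Measure.quasiMeasurePreserving_fst.ae h1,
      Measure.quasiMeasurePreserving_snd.ae h1] with z h2 h3 using ⟨h2, h3⟩
  calc M * r ^ d ≤ |M| * r ^ d := by gcongr; exact le_abs_self M
    _ = K / (r * D) ^ d * ((r ^ d * V) ^ 2 / 2) := by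
        rw [hK, mul_pow]
        field_simp
    _ ≤ K / (r * D) ^ d * (m.prod m).real (nearPairs d R)ᶜ := by gcongr
    _ = ∫ z in (nearPairs d R)ᶜ, K / (r * D) ^ d ∂(m.prod m) := by
        rw [setIntegral_const, smul_eq_mul, mul_comm]
    _ = ∫ z, (nearPairs d R)ᶜ.indicator (fun _ ↦ K / (r * D) ^ d) z ∂(m.prod m) := by
        rw [integral_indicator (measurableSet_nearPairs R).compl]
    _ ≤ ∫ z, b z ∂(m.prod m) := by
        refine integral_mono_ae
          ((integrable_const _).indicator (measurableSet_nearPairs R).compl) hint ?_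
        filter_upwards [hmem] with z hz
        by_cases hzn : z ∈ nearPairs d R
        · rw [Set.indicator_of_notMem (by simpa using hzn)]
          exact hb0 z
        · rw [Set.indicator_of_mem (by simpa using hzn)]
          have hzR : R < ‖z.1 - z.2‖ := not_le.1 hzn
          obtain ⟨h1, h2⟩ := hR _ hzR.le
          rw [hbf z (sub_ne_zero.1 (norm_pos_iff.1 h2))]
          calc K / (r * D) ^ d ≤ K / ‖z.1 - z.2‖ ^ d := by
                gcongr
                exact hD r hr0.le _ hz.1 _ hz.2
            _ ≤ f ‖z.1 - z.2‖ := by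
                rw [div_le_iff₀ (by positivity), mul_comm]
                exact h1

/-- Far pairs are compared through `ε * b`; at near pairs only `b' ≤ 1` is used, at the cost of
their measure. -/
theorem integral_le_of_le_far (hΔ : IsWindow Δ) (hbm : Measurable b) (hbm' : Measurable b')
    (hb0 : ∀ z, 0 ≤ b z) (hb1 : ∀ z, b z ≤ 1) (hb0' : ∀ z, 0 ≤ b' z) (hb1' : ∀ z, b' z ≤ 1)
    {ε R : ℝ} (hε : 0 ≤ ε) (hfar : ∀ z, R < ‖z.1 - z.2‖ → b' z ≤ ε * b z) {r : ℝ} (hr : 0 ≤ r) :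
    ∫ z, b' z ∂((volume.restrict (r • Δ)).prod (volume.restrict (r • Δ)))
      ≤ ε * ∫ z, b z ∂((volume.restrict (r • Δ)).prod (volume.restrict (r • Δ)))
        + volume.real Δ * volume.real (Metric.closedBall (0 : EuclideanSpace ℝ (Fin d)) R)
          * r ^ d := by
  have hfin := hΔ.isFiniteMeasure_restrict r
  have hnear := measureReal_prod_nearPairs_le (r • Δ) R
  rw [volume_real_smul hr] at hnear
  set m := volume.restrict (r • Δ) with hm
  have hint : ∀ g : EuclideanSpace ℝ (Fin d) × EuclideanSpace ℝ (Fin d) → ℝ, Measurable g →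
      (∀ z, 0 ≤ g z) → (∀ z, g z ≤ 1) → Integrable g (m.prod m) := fun g h1 h2 h3 ↦
    (integrable_const (1 : ℝ)).mono' h1.aestronglyMeasurable (.of_forall fun z ↦ by
      rw [Real.norm_eq_abs, abs_of_nonneg (h2 z)]
      exact h3 z)
  have hi := hint b hbm hb0 hb1
  have hi' := hint b' hbm' hb0' hb1'
  have hind : Integrable ((nearPairs d R).indicator fun _ ↦ (1 : ℝ)) (m.prod m) :=
    (integrable_const _).indicator (measurableSet_nearPairs R)
  calc ∫ z, b' z ∂(m.prod m)
      ≤ ∫ z, (ε * b z + (nearPairs d R).indicator (fun _ ↦ 1) z) ∂(m.prod m) := by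
        refine integral_mono hi' ((hi.const_mul ε).add hind) fun z ↦ ?_
        by_cases hzn : z ∈ nearPairs d R
        · simp only [Set.indicator_of_mem hzn]
          linarith [hb1' z, mul_nonneg hε (hb0 z)]
        · simp only [Set.indicator_of_notMem hzn, add_zero]
          exact hfar z (not_le.1 hzn)
    _ = ε * ∫ z, b z ∂(m.prod m) + (m.prod m).real (nearPairs d R) := by
        rw [integral_add (hi.const_mul ε) hind, integral_const_mul,
          integral_indicator (measurableSet_nearPairs R), setIntegral_const, smul_eq_mul, mul_one]
    _ ≤ _ := by
        refine add_le_add_right (hnear.trans (le_of_eq ?_)) _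
        ring

end IsWindow

/-! ### Comparison of covariance integrals -/

section Covariance

variable {ι Ω : Type*} [Fintype ι] [MeasurableSpace Ω] {P : Measure Ω}
  {η : ι → EuclideanSpace ℝ (Fin d) → Ω → ℝ} {e : ι → ℝ} {L : ι → ℝ → ℝ}

/-- The variance of `∫_{Δ(r)} e_v(η(x)) dx`, divided by `v!`. -/
noncomputable def covInt (P : Measure Ω) (η : ι → EuclideanSpace ℝ (Fin d) → Ω → ℝ)
    (Δ : Set (EuclideanSpace ℝ (Fin d))) (v : ι → ℕ) (r : ℝ) : ℝ :=
  ∫ z, covProd P η v z ∂((volume.restrict (r • Δ)).prod (volume.restrict (r • Δ)))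

theorem covInt_nonneg (hη : IsGaussianVectorField P η e L) (hL : ∀ j, SlowlyVarying (L j))
    (v : ι → ℕ) (r : ℝ) : 0 ≤ covInt P η Δ v r :=
  integral_nonneg fun z ↦ hη.covProd_nonneg hL v z

/-- The quotient of the kernels of `v` and `u` is a positive power of the distance times a slowly
varying function, hence tends to infinity. -/
theorem exists_covProd_le_mul (hη : IsGaussianVectorField P η e L)
    (hL : ∀ j, SlowlyVarying (L j)) {u v : ι → ℕ} (huv : exponentSum e v < exponentSum e u)
    {ε : ℝ} (hε : 0 < ε) :
    ∃ R : ℝ, ∀ z, R < ‖z.1 - z.2‖ → covProd P η u z ≤ ε * covProd P η v z := by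
  have hs : ∀ w : ι → ℕ, SlowlyVarying fun t ↦ ∏ j, L j t ^ w j := fun w ↦
    SlowlyVarying.prod (L := fun j t ↦ L j t ^ w j) Finset.univ fun j ↦ (hL j).pow (w j)
  have hlim := ((hs v).mul (hs u).inv).tendsto_rpow_mul_atTop (sub_pos.2 huv)
  obtain ⟨R, hR⟩ := eventually_atTop.1
    ((hlim.eventually (eventually_ge_atTop ε⁻¹)).and (eventually_gt_atTop (0 : ℝ)))
  refine ⟨R, fun z hz ↦ ?_⟩
  obtain ⟨h1, h2⟩ := hR _ hz.le
  have hne : z.1 ≠ z.2 := sub_ne_zero.1 (norm_pos_iff.1 h2)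
  rw [hη.covProd_eq u hne, hη.covProd_eq v hne]
  set ρ := ‖z.1 - z.2‖
  have hu := (hs u).pos ρ h2
  have h3 : ρ ^ (-exponentSum e u) * (∏ j, L j ρ ^ u j) *
      (ρ ^ (exponentSum e u - exponentSum e v) *
        ((∏ j, L j ρ ^ v j) * (∏ j, L j ρ ^ u j)⁻¹))
      = ρ ^ (-exponentSum e v) * ∏ j, L j ρ ^ v j := by
    rw [show -exponentSum e v = -exponentSum e u + (exponentSum e u - exponentSum e v) by ring,
      Real.rpow_add h2]
    field_simp
  rw [← h3, mul_left_comm ε]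
  have h4 : 0 ≤ ρ ^ (-exponentSum e u) * ∏ j, L j ρ ^ u j := by positivity
  refine le_mul_of_one_le_right h4 ?_
  rwa [← inv_le_iff_one_le_mul₀' hε]

variable [IsProbabilityMeasure P]

theorem covInt_anti (hη : IsGaussianVectorField P η e L) (hL : ∀ j, SlowlyVarying (L j))
    (hΔ : IsWindow Δ) {u v : ι → ℕ} (huv : u ≤ v) (r : ℝ) :
    covInt P η Δ v r ≤ covInt P η Δ u r := by
  have hfin := hΔ.isFiniteMeasure_restrict r
  exact integral_mono (hη.integrable_covProd hL v _) (hη.integrable_covProd hL u _)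
    fun z ↦ hη.covProd_anti hL huv z

theorem eventually_mul_pow_le_covInt (hη : IsGaussianVectorField P η e L)
    (hL : ∀ j, SlowlyVarying (L j)) (hΔ : IsWindow Δ) (hd : d ≠ 0) {v : ι → ℕ}
    (hv : exponentSum e v < d) (M : ℝ) :
    ∀ᶠ r : ℝ in atTop, M * r ^ d ≤ covInt P η Δ v r := by
  refine hΔ.eventually_mul_pow_le_integral hd (hη.measurable_covProd v) (hη.covProd_nonneg hL v)
    (hη.covProd_le_one hL v) (f := fun ρ ↦ ρ ^ (-exponentSum e v) * ∏ j, L j ρ ^ v j)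
    (fun z hz ↦ hη.covProd_eq v hz) ?_ M
  have hs := SlowlyVarying.prod (L := fun j t ↦ L j t ^ v j) Finset.univ fun j ↦ (hL j).pow (v j)
  refine (hs.tendsto_rpow_mul_atTop (sub_pos.2 hv)).congr' ?_
  filter_upwards [eventually_gt_atTop 0] with ρ hρ
  rw [sub_eq_add_neg, Real.rpow_add hρ, Real.rpow_natCast, mul_assoc]

theorem eventually_covInt_le_mul (hη : IsGaussianVectorField P η e L)
    (hL : ∀ j, SlowlyVarying (L j)) (hΔ : IsWindow Δ) (hd : d ≠ 0) {u v : ι → ℕ}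
    (hv : exponentSum e v < d) (huv : exponentSum e v < exponentSum e u) {ε : ℝ} (hε : 0 < ε) :
    ∀ᶠ r : ℝ in atTop, covInt P η Δ u r ≤ ε * covInt P η Δ v r := by
  obtain ⟨R, hR⟩ := exists_covProd_le_mul hη hL huv (half_pos hε)
  set C := volume.real Δ * volume.real (Metric.closedBall (0 : EuclideanSpace ℝ (Fin d)) R)
  -- The constant `C / (ε / 2)` makes the near-diagonal term `C * r ^ d` at most `ε / 2` times the
  -- covariance integral of `v`.
  filter_upwards [eventually_mul_pow_le_covInt hη hL hΔ hd hv (C / (ε / 2)),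
    eventually_ge_atTop 0] with r h1 h2
  have h3 := hΔ.integral_le_of_le_far (hη.measurable_covProd v) (hη.measurable_covProd u)
    (hη.covProd_nonneg hL v) (hη.covProd_le_one hL v) (hη.covProd_nonneg hL u)
    (hη.covProd_le_one hL u) (half_pos hε).le hR h2
  rw [div_mul_eq_mul_div, div_le_iff₀ (half_pos hε)] at h1
  change covInt P η Δ u r ≤ ε / 2 * covInt P η Δ v r + C * r ^ d at h3
  linarith

/-- The previous bound holds uniformly in all multi-indices with a larger exponent, because the
minimal ones are finitely many. -/
theorem eventually_forall_covInt_le_mul (hη : IsGaussianVectorField P η e L)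
    (hL : ∀ j, SlowlyVarying (L j)) (hΔ : IsWindow Δ) (hd : d ≠ 0) {v : ι → ℕ}
    (hv : exponentSum e v < d) {ε : ℝ} (hε : 0 < ε) :
    ∀ᶠ r : ℝ in atTop, ∀ u, exponentSum e v < exponentSum e u →
      covInt P η Δ u r ≤ ε * covInt P η Δ v r := by
  set S : Set (ι → ℕ) := {u | Minimal (fun u ↦ exponentSum e v < exponentSum e u) u}
  -- Dickson's lemma: the product order on multi-indices is a well quasi-order, so antichains are
  -- finite.
  have hS : S.Finite := (setOfPred_minimal_antichain _).finite_of_partiallyWellOrderedOn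
    (Set.isPWO_of_wellQuasiOrderedLE S)
  have h1 : ∀ᶠ r : ℝ in atTop, ∀ u ∈ S, covInt P η Δ u r ≤ ε * covInt P η Δ v r :=
    (hS.eventually_all).2 fun u hu ↦ eventually_covInt_le_mul hη hL hΔ hd hv hu.1 hε
  filter_upwards [h1] with r hr u hu
  obtain ⟨w, hwu, hw⟩ := exists_minimal_le_of_wellFoundedLT
    (fun u ↦ exponentSum e v < exponentSum e u) u hu
  exact (covInt_anti hη hL hΔ hwu r).trans (hr w hw)

end Covariance

end Window

/-! ### From `L²` closeness to equality of normalized limits -/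

section Normalization

variable {Ω : Type*} [MeasurableSpace Ω] {P : Measure Ω}

theorem integral_sq_eq_toReal_eLpNorm_sq {f : Ω → ℝ} (hf : MemLp f 2 P) :
    ∫ ω, f ω ^ 2 ∂P = (eLpNorm f 2 P).toReal ^ 2 := by
  have h0 : 0 ≤ ∫ ω, f ω ^ 2 ∂P := integral_nonneg fun _ ↦ sq_nonneg _
  rw [hf.eLpNorm_eq_integral_rpow_norm (by norm_num) (by norm_num)]
  simp only [ENNReal.toReal_ofNat, Real.rpow_two, Real.norm_eq_abs, sq_abs]
  rw [ENNReal.toReal_ofReal (by positivity), ← Real.rpow_natCast, ← Real.rpow_mul h0]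
  norm_num

theorem tendstoInMeasure_of_tendsto_integral_sq {f g : ℝ → Ω → ℝ} (hf : ∀ r, MemLp (f r) 2 P)
    (hg : ∀ r, MemLp (g r) 2 P)
    (h : Tendsto (fun r ↦ ∫ ω, (f r ω - g r ω) ^ 2 ∂P) atTop (𝓝 0)) :
    TendstoInMeasure P (f - g) atTop 0 := by
  refine tendstoInMeasure_of_tendsto_eLpNorm (p := 2) (by norm_num)
    (fun r ↦ ((hf r).sub (hg r)).aestronglyMeasurable) aestronglyMeasurable_zero ?_
  have h1 : ∀ r, eLpNorm ((f - g) r - 0) 2 P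
      = ENNReal.ofReal (√(∫ ω, (f r ω - g r ω) ^ 2 ∂P)) := by
    intro r
    have h2 := integral_sq_eq_toReal_eLpNorm_sq ((hf r).sub (hg r))
    simp only [Pi.sub_apply] at h2
    rw [h2, Real.sqrt_sq ENNReal.toReal_nonneg,
      ENNReal.ofReal_toReal ((hf r).sub (hg r)).eLpNorm_ne_top, sub_zero, Pi.sub_apply]
  change Tendsto (fun r ↦ eLpNorm ((f - g) r - 0) 2 P) atTop (𝓝 0)
  simp only [h1]
  have h3 := (ENNReal.continuous_ofReal.comp Real.continuous_sqrt).tendsto 0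
  simp only [Function.comp, Real.sqrt_zero, ENNReal.ofReal_zero] at h3
  exact h3.comp h

/-- Expanding the squares, `‖K/k - S/s‖² = (‖K - S‖² - (k - s)²) / (k s)`, which is at most `ε s /
k`. -/
theorem integral_sq_normalized_sub_le {K S : Ω → ℝ} (hK : MemLp K 2 P) (hS : MemLp S 2 P)
    {k s ε : ℝ} (hk : 0 ≤ k) (hs : 0 < s) (hkK : ∫ ω, K ω ^ 2 ∂P = k ^ 2)
    (hsS : ∫ ω, S ω ^ 2 ∂P = s ^ 2) (hε : ε ≤ 1 / 4)
    (h : ∫ ω, (K ω - S ω) ^ 2 ∂P ≤ ε * s ^ 2) :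
    ∫ ω, (K ω / k - S ω / s) ^ 2 ∂P ≤ 2 * ε := by
  have hi1 := hK.integrable_sq
  have hi2 := hS.integrable_sq
  have hi3 : Integrable (fun ω ↦ K ω * S ω) P := hK.integrable_mul hS
  have hi12 : ∀ a b : ℝ, Integrable (fun ω ↦ a * K ω ^ 2 + b * S ω ^ 2) P := fun a b ↦
    (hi1.const_mul a).add (hi2.const_mul b)
  have hi4 : Integrable (fun ω ↦ (K ω - S ω) ^ 2) P := (hK.sub hS).integrable_sq
  have h1 : ∫ ω, (K ω - S ω) ^ 2 ∂P = k ^ 2 + s ^ 2 - 2 * ∫ ω, K ω * S ω ∂P := by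
    have h0 : ∀ ω, (K ω - S ω) ^ 2 = 1 * K ω ^ 2 + 1 * S ω ^ 2 - 2 * (K ω * S ω) := fun ω ↦ by ring
    simp only [h0]
    rw [integral_sub (hi12 1 1) (hi3.const_mul 2), integral_add (hi1.const_mul 1) (hi2.const_mul 1)]
    simp only [integral_const_mul, hkK, hsS, one_mul]
  have h2 : s ^ 2 ≤ 2 * k ^ 2 + 2 * ∫ ω, (K ω - S ω) ^ 2 ∂P := by
    rw [← hkK, ← hsS, ← integral_const_mul, ← integral_const_mul,
      ← integral_add (hi1.const_mul 2) (hi4.const_mul 2)]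
    exact integral_mono hi2 ((hi1.const_mul 2).add (hi4.const_mul 2)) fun ω ↦ by
      simp only
      nlinarith [sq_nonneg (2 * K ω - S ω)]
  -- Since `ε ≤ 1/4`, the preceding bound gives `s² ≤ 2k² + s²/2`; in particular `k` is positive.
  have hsk : s ≤ 2 * k := by nlinarith
  have hk0 : 0 < k := by linarith
  have h3 : ∫ ω, (K ω / k - S ω / s) ^ 2 ∂P = 2 - 2 * (∫ ω, K ω * S ω ∂P) / (k * s) := by
    have h4 : ∀ ω, (K ω / k - S ω / s) ^ 2
        = (k ^ 2)⁻¹ * K ω ^ 2 + (s ^ 2)⁻¹ * S ω ^ 2 - 2 / (k * s) * (K ω * S ω) := by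
      intro ω
      field_simp
      ring
    simp only [h4]
    rw [integral_sub (hi12 _ _) (hi3.const_mul _),
      integral_add (hi1.const_mul _) (hi2.const_mul _), integral_const_mul, integral_const_mul,
      integral_const_mul, hkK, hsS]
    field_simp
    ring
  rw [h3, sub_le_iff_le_add, ← sub_le_iff_le_add', le_div_iff₀ (by positivity)]
  have hε0 : 0 ≤ ε * s ^ 2 := (integral_nonneg fun _ ↦ sq_nonneg _).trans h
  have hε1 : 0 ≤ ε := nonneg_of_mul_nonneg_left hε0 (by positivity)
  nlinarith [sq_nonneg (k - s), mul_nonneg hε1 hs.le,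
    mul_le_mul_of_nonneg_left hsk (mul_nonneg hε1 hs.le)]

/-- Two families of centred variables whose difference is negligible in `L²` have the same
normalized limits. -/
theorem normalizedLimit_iff_of_integral_sq_sub_le [IsProbabilityMeasure P] {K S : ℝ → Ω → ℝ}
    (hK : ∀ r, MemLp (K r) 2 P) (hS : ∀ r, MemLp (S r) 2 P) (hK0 : ∀ r, ∫ ω, K r ω ∂P = 0)
    (hS0 : ∀ r, ∫ ω, S r ω ∂P = 0) (hpos : ∀ᶠ r in atTop, 0 < ∫ ω, S r ω ^ 2 ∂P)
    (h : ∀ ε > 0, ∀ᶠ r in atTop,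
      ∫ ω, (K r ω - S r ω) ^ 2 ∂P ≤ ε * ∫ ω, S r ω ^ 2 ∂P)
    (μ : Measure ℝ) [IsProbabilityMeasure μ] :
    NormalizedLimit P K μ ↔ NormalizedLimit P S μ := by
  have hsd : ∀ X : Ω → ℝ, MemLp X 2 P → ∫ ω, X ω ∂P = 0 →
      ∫ ω, X ω ^ 2 ∂P = √(variance X P) ^ 2 := fun X hX hX0 ↦ by
    rw [Real.sq_sqrt (variance_nonneg X P),
      variance_of_integral_eq_zero hX.aestronglyMeasurable.aemeasurable hX0]
  have hlim : Tendsto (fun r ↦ ∫ ω, (K r ω / √(variance (K r) P)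
      - S r ω / √(variance (S r) P)) ^ 2 ∂P) atTop (𝓝 0) := by
    refine tendsto_order.2 ⟨fun a ha ↦ .of_forall fun r ↦
      ha.trans_le (integral_nonneg fun _ ↦ sq_nonneg _), fun a ha ↦ ?_⟩
    filter_upwards [h (min (1 / 4) (a / 4)) (by positivity), hpos] with r h1 h2
    rw [hsd _ (hS r) (hS0 r)] at h1 h2
    have h3 : 0 < √(variance (S r) P) := by
      refine lt_of_le_of_ne (Real.sqrt_nonneg _) fun h0 ↦ ?_
      rw [← h0] at h2
      norm_num at h2
    refine (integral_sq_normalized_sub_le (hK r) (hS r) (Real.sqrt_nonneg _) h3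
      (hsd _ (hK r) (hK0 r)) (hsd _ (hS r) (hS0 r)) (min_le_left _ _) h1).trans_lt ?_
    linarith [min_le_right (1 / 4) (a / 4)]
  have hlim' : Tendsto (fun r ↦ ∫ ω, (S r ω / √(variance (S r) P)
      - K r ω / √(variance (K r) P)) ^ 2 ∂P) atTop (𝓝 0) := by
    refine hlim.congr fun r ↦ integral_congr_ae (.of_forall fun ω ↦ ?_)
    simp only
    ring
  have hKm : ∀ r, MemLp (fun ω ↦ K r ω / √(variance (K r) P)) 2 P := fun r ↦ by
    simpa only [div_eq_mul_inv] using (hK r).mul_const _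
  have hSm : ∀ r, MemLp (fun ω ↦ S r ω / √(variance (S r) P)) 2 P := fun r ↦ by
    simpa only [div_eq_mul_inv] using (hS r).mul_const _
  -- Slutsky's theorem in both directions: the difference tends to zero in `L²`, hence in measure.
  exact ⟨fun hX ↦ tendstoInDistribution_of_tendstoInMeasure_sub _ _ hX
      (tendstoInMeasure_of_tendsto_integral_sq hSm hKm hlim')
      fun r ↦ (hSm r).aestronglyMeasurable.aemeasurable,
    fun hX ↦ tendstoInDistribution_of_tendstoInMeasure_sub _ _ hX
      (tendstoInMeasure_of_tendsto_integral_sq hKm hSm hlim)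
      fun r ↦ (hKm r).aestronglyMeasurable.aemeasurable⟩

end Normalization

/-! ### The reduction theorem -/

section Reduction

variable {d : ℕ} {ι Ω : Type*} [Fintype ι] [MeasurableSpace Ω] {P : Measure Ω}
  {η : ι → EuclideanSpace ℝ (Fin d) → Ω → ℝ} {e : ι → ℝ} {L : ι → ℝ → ℝ}
  {Δ : Set (EuclideanSpace ℝ (Fin d))} {G : (ι → ℝ) → ℝ} {κ : ℕ} {γ : ℝ}

theorem integral_hermiteProd_eq_zero {v : ι → ℕ} (hv : v ≠ 0) :
    ∫ w, hermiteProd v w ∂(stdGaussianMeasure ι) = 0 := by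
  have h := integral_hermiteProd_mul_hermiteProd_stdGaussianMeasure v 0
  rw [if_neg hv] at h
  simpa [hermiteProd_eq, hermiteReal_zero] using h

theorem integral_eq_hermiteCoeff_zero (G : (ι → ℝ) → ℝ) :
    ∫ w, G w ∂(stdGaussianMeasure ι) = hermiteCoeff G 0 := by
  simp [hermiteCoeff, hermiteProd_eq, hermiteReal_zero]

theorem ne_zero_of_mem_Nplus (hκ : IsHermiteRank G κ) {v : ι → ℕ} (hv : v ∈ Nplus G κ) :
    v ≠ 0 := by
  rintro rfl
  have h1 := hv.1
  have h2 := hκ.one_le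
  simp at h1
  omega

/-- The rank condition covers only orders from `1` to `κ - 1`; order zero is excluded by `C_0 = 0`.
-/
theorem mem_Nplus_of_hermiteCoeff_ne_zero (hκ : IsHermiteRank G κ) (hG0 : hermiteCoeff G 0 = 0)
    {v : ι → ℕ} (hv : hermiteCoeff G v ≠ 0) : v ∈ Nplus G κ := by
  refine ⟨?_, hv⟩
  by_contra! hlt
  refine hv (hκ.coeff_eq_zero v ?_ hlt)
  by_contra! h0
  refine hv ?_
  have hv0 : v = 0 := by
    funext j
    have := Finset.sum_eq_zero_iff.1 (Nat.lt_one_iff.1 h0) j (Finset.mem_univ j)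
    exact this
  rw [hv0, hG0]

/-- All multi-indices occurring in `∑_l K̃*_{r,l}`. -/
theorem exists_finset_KstarSum_eq (Ω : Type*) (he : ∀ j, 0 < e j) (G : (ι → ℝ) → ℝ) (κ : ℕ) (γ : ℝ) :
    ∃ T : Finset (ι → ℕ), (∀ v, v ∈ T ↔ v ∈ Nplus G κ ∧ exponentSum e v = γ) ∧
      ∀ (Δ : Set (EuclideanSpace ℝ (Fin d))) (η : ι → EuclideanSpace ℝ (Fin d) → Ω → ℝ) r ω,
        KstarSum Δ η G κ e γ r ω = ∑ v ∈ T,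
          hermiteCoeff G v / (∏ j, ((v j).factorial : ℝ)) *
            windowIntegral Δ η (hermiteProd v) r ω := by
  classical
  -- A `∑ᶠ` with infinite support would default to zero; finiteness of the set of levels makes it an
  -- actual sum.
  have hfin := Lplus_finite G κ e γ he
  refine ⟨hfin.toFinset.biUnion (Nstar G κ e γ), fun v ↦ ?_, fun Δ η r ω ↦ ?_⟩
  · simp only [Finset.mem_biUnion, Set.Finite.mem_toFinset, mem_Nstar]
    refine ⟨fun ⟨l, _, _, h⟩ ↦ h, fun h ↦ ⟨∑ j, v j, ⟨h.1.1, v, mem_Nstar.2 ⟨rfl, h⟩⟩, rfl, h⟩⟩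
  · rw [KstarSum, finsum_mem_eq_finite_toFinset_sum _ hfin, Finset.sum_biUnion]
    · rfl
    · intro l _ l' _ hll
      refine Finset.disjoint_left.2 fun v hv hv' ↦ hll ?_
      rw [← (mem_Nstar.1 hv).1, (mem_Nstar.1 hv').1]

variable [IsProbabilityMeasure P]

/-- The `L²` distance of `∫_{Δ(r)} G(η(x)) dx` from the part of its Hermite expansion over `T` is
controlled by the covariance integrals of the remaining multi-indices. -/
theorem integral_sq_integral_sub_le (hη : IsGaussianVectorField P η e L)
    (hL : ∀ j, SlowlyVarying (L j)) (hG : MemLp G 2 (stdGaussianMeasure ι))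
    (m : Measure (EuclideanSpace ℝ (Fin d))) [IsFiniteMeasure m] (T : Finset (ι → ℕ)) {b : ℝ}
    (hb : 0 ≤ b)
    (hT : ∀ v, v ∉ T → hermiteCoeff G v ≠ 0 → ∫ z, covProd P η v z ∂(m.prod m) ≤ b) :
    ∫ ω, (∫ x, G (fun j ↦ η j x ω) ∂m - ∫ x, ∑ v ∈ T, hermiteCoeff G v /
      (∏ j, ((v j).factorial : ℝ)) * hermiteProd v (fun j ↦ η j x ω) ∂m) ^ 2 ∂P
      ≤ 2 * (b * ‖hG.toLp G‖ ^ 2) := by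
  classical
  set c : (ι → ℕ) → ℝ := fun v ↦ hermiteCoeff G v / (∏ j, ((v j).factorial : ℝ)) with hc
  have hQ := fun s : Finset (ι → ℕ) ↦ IsGaussianVectorField.memLp_hermite_sum s c
  -- The difference splits into a finite Hermite sum `A` over `s \ T`, bounded uniformly in `s` by
  -- Bessel, and a tail `D` contributing at most `δ`. The choice of `δ'` gives `∫ D² ≤ δ / 2`.
  refine le_of_forall_pos_le_add fun δ hδ ↦ ?_
  set δ' : ℝ := √(δ / (2 * (m.real Set.univ ^ 2 + 1))) with hδ'
  have hδ'0 : 0 < δ' := Real.sqrt_pos.2 (by positivity)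
  obtain ⟨s, hs, hsδ⟩ := exists_eLpNorm_sub_hermite_sum_le hG T hδ'0
  have hR : MemLp (fun w ↦ G w - ∑ v ∈ s, c v * hermiteProd v w) 2 (stdGaussianMeasure ι) :=
    hG.sub (hQ s)
  have hRle : ∫ w, (G w - ∑ v ∈ s, c v * hermiteProd v w) ^ 2 ∂(stdGaussianMeasure ι) ≤ δ' ^ 2 := by
    rw [integral_sq_eq_toReal_eLpNorm_sq hR]
    gcongr
    exact ENNReal.toReal_le_of_le_ofReal hδ'0.le hsδ
  set A : Ω → ℝ := fun ω ↦ ∫ x, ∑ v ∈ s \ T, c v * hermiteProd v (fun j ↦ η j x ω) ∂m with hA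
  set D : Ω → ℝ := fun ω ↦
    ∫ x, (G (fun j ↦ η j x ω) - ∑ v ∈ s, c v * hermiteProd v (fun j ↦ η j x ω)) ∂m with hD
  have hAm : MemLp A 2 P := hη.memLp_integral_comp m (hQ (s \ T))
  have hDm : MemLp D 2 P := hη.memLp_integral_comp m hR
  have hdecomp : ∀ᵐ ω ∂P, ∫ x, G (fun j ↦ η j x ω) ∂m -
      ∫ x, ∑ v ∈ T, c v * hermiteProd v (fun j ↦ η j x ω) ∂m = A ω + D ω := by
    filter_upwards [hη.ae_integrable m hG, hη.ae_integrable m (hQ T),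
      hη.ae_integrable m (hQ (s \ T)), hη.ae_integrable m hR] with ω h1 h2 h3 h4
    rw [← integral_sub h1 h2, hA, hD, ← integral_add h3 h4]
    refine integral_congr_ae (.of_forall fun x ↦ ?_)
    simp only
    rw [← Finset.sum_sdiff hs]
    ring
  have hAle : ∫ ω, A ω ^ 2 ∂P ≤ b * ‖hG.toLp G‖ ^ 2 := by
    rw [hη.integral_sq_integral_hermite_sum m hL]
    refine le_trans ?_ (mul_le_mul_of_nonneg_left (sum_hermiteCoeff_sq_le hG (s \ T)) hb)
    rw [Finset.mul_sum]
    refine Finset.sum_le_sum fun v hv ↦ ?_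
    have hf := prod_factorial_pos v
    rw [show c v ^ 2 * (∏ j, ((v j).factorial : ℝ))
        = hermiteCoeff G v ^ 2 / (∏ j, ((v j).factorial : ℝ)) by
      simp only [hc]
      field_simp, mul_comm b]
    rcases eq_or_ne (hermiteCoeff G v) 0 with h0 | h0
    · simp [h0]
    · exact mul_le_mul_of_nonneg_left (hT v (Finset.mem_sdiff.1 hv).2 h0) (by positivity)
  have hDle : ∫ ω, D ω ^ 2 ∂P ≤ δ / 2 := by
    refine (hη.integral_sq_integral_comp_le m hR).trans
      ((mul_le_mul_of_nonneg_left hRle (sq_nonneg _)).trans ?_)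
    rw [hδ', Real.sq_sqrt (by positivity), mul_div_assoc', div_le_iff₀ (by positivity)]
    nlinarith
  calc ∫ ω, (∫ x, G (fun j ↦ η j x ω) ∂m -
        ∫ x, ∑ v ∈ T, c v * hermiteProd v (fun j ↦ η j x ω) ∂m) ^ 2 ∂P
      = ∫ ω, (A ω + D ω) ^ 2 ∂P := integral_congr_ae (hdecomp.mono fun ω h ↦ by simp only [h])
    _ ≤ ∫ ω, (2 * A ω ^ 2 + 2 * D ω ^ 2) ∂P :=
        integral_mono (hAm.add hDm).integrable_sq
          ((hAm.integrable_sq.const_mul 2).add (hDm.integrable_sq.const_mul 2)) fun ω ↦ by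
            simp only
            nlinarith [sq_nonneg (A ω - D ω)]
    _ = 2 * ∫ ω, A ω ^ 2 ∂P + 2 * ∫ ω, D ω ^ 2 ∂P := by
        rw [integral_add (hAm.integrable_sq.const_mul 2) (hDm.integrable_sq.const_mul 2),
          integral_const_mul, integral_const_mul]
    _ ≤ 2 * (b * ‖hG.toLp G‖ ^ 2) + δ := by linarith

theorem exponentSum_nonneg (he : ∀ j, 0 < e j) (v : ι → ℕ) : 0 ≤ exponentSum e v :=
  Finset.sum_nonneg fun j _ ↦ mul_nonneg (he j).le (Nat.cast_nonneg _)

/-- The reduction theorem for a vector field with arbitrary positive decay exponents. -/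
theorem normalizedLimit_windowIntegral_iff (hη : IsGaussianVectorField P η e L)
    (hL : ∀ j, SlowlyVarying (L j)) (hΔ : IsWindow Δ) (he : ∀ j, 0 < e j)
    (hG : MemLp G 2 (stdGaussianMeasure ι)) (hG0 : hermiteCoeff G 0 = 0)
    (hκ : IsHermiteRank G κ) (hγ : IsLeast (exponentSum e '' Nplus G κ) γ) (hγd : γ < d)
    (μ : Measure ℝ) [IsProbabilityMeasure μ] :
    NormalizedLimit P (windowIntegral Δ η G) μ ↔
      NormalizedLimit P (KstarSum Δ η G κ e γ) μ := by
  obtain ⟨T, hT, hKT⟩ := exists_finset_KstarSum_eq (d := d) Ω he G κ γ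
  obtain ⟨⟨v₀, hv₀, hv₀γ⟩, hmin⟩ := hγ
  have hv₀d : exponentSum e v₀ < d := hv₀γ ▸ hγd
  -- In dimension zero `γ < d` would make a sum of nonnegative terms negative.
  have hd : d ≠ 0 := by
    rintro rfl
    exact absurd (hv₀d.trans_le (by simp)) (exponentSum_nonneg he v₀).not_gt
  set c : (ι → ℕ) → ℝ := fun v ↦ hermiteCoeff G v / (∏ j, ((v j).factorial : ℝ)) with hc
  have hQ := IsGaussianVectorField.memLp_hermite_sum T c
  have hfin := hΔ.isFiniteMeasure_restrict
  have hS : ∀ r, KstarSum Δ η G κ e γ r =ᵐ[P] fun ω ↦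
      ∫ x in r • Δ, ∑ v ∈ T, c v * hermiteProd v (fun j ↦ η j x ω) := by
    intro r
    have h1 : ∀ᵐ ω ∂P, ∀ v ∈ T, Integrable (fun x ↦ hermiteProd v fun j ↦ η j x ω)
        (volume.restrict (r • Δ)) := (Finset.eventually_all T).2 fun v _ ↦
      hη.ae_integrable (volume.restrict (r • Δ)) (memLp_two_hermiteProd v)
    filter_upwards [h1] with ω h2
    rw [hKT, integral_finsetSum _ fun v hv ↦ (h2 v hv).const_mul _]
    simp only [integral_const_mul]
    rfl
  have hSm : ∀ r, MemLp (KstarSum Δ η G κ e γ r) 2 P := fun r ↦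
    (hη.memLp_integral_comp (volume.restrict (r • Δ)) hQ).ae_eq (hS r).symm
  have hSsq : ∀ r, ∫ ω, KstarSum Δ η G κ e γ r ω ^ 2 ∂P
      = ∑ v ∈ T, c v ^ 2 * (∏ j, ((v j).factorial : ℝ)) * covInt P η Δ v r := by
    intro r
    rw [integral_congr_ae (g := fun ω ↦ (∫ x in r • Δ, ∑ v ∈ T,
      c v * hermiteProd v (fun j ↦ η j x ω)) ^ 2) ((hS r).mono fun ω h ↦ by simp only [h])]
    exact hη.integral_sq_integral_hermite_sum _ hL T c
  -- All contributions to the leading variance are nonnegative, so that of `v₀` alone bounds it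
  -- below, even when other multi-indices share the exponent `γ` with different slowly varying
  -- factors.
  set c₀ : ℝ := c v₀ ^ 2 * ∏ j, ((v₀ j).factorial : ℝ) with hc₀
  have hc₀pos : 0 < c₀ :=
    mul_pos (sq_pos_of_ne_zero (div_ne_zero hv₀.2 (prod_factorial_pos v₀).ne'))
      (prod_factorial_pos v₀)
  have hSlow : ∀ r, c₀ * covInt P η Δ v₀ r ≤ ∫ ω, KstarSum Δ η G κ e γ r ω ^ 2 ∂P := by
    intro r
    rw [hSsq]
    exact Finset.single_le_sum
      (f := fun v ↦ c v ^ 2 * (∏ j, ((v j).factorial : ℝ)) * covInt P η Δ v r)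
      (fun v _ ↦ mul_nonneg (mul_nonneg (sq_nonneg _) (prod_factorial_pos v).le)
        (covInt_nonneg hη hL v r)) ((hT v₀).2 ⟨hv₀, hv₀γ⟩)
  refine normalizedLimit_iff_of_integral_sq_sub_le
    (fun r ↦ hη.memLp_integral_comp (volume.restrict (r • Δ)) hG) hSm (fun r ↦ ?_) (fun r ↦ ?_)
    ?_ (fun ε hε ↦ ?_) μ
  · refine (hη.integral_integral_comp (volume.restrict (r • Δ)) hG).trans ?_
    rw [integral_eq_hermiteCoeff_zero, hG0, mul_zero]
  · rw [integral_congr_ae (hS r)]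
    refine (hη.integral_integral_comp (volume.restrict (r • Δ)) hQ).trans ?_
    rw [integral_finsetSum _ fun v _ ↦
      ((memLp_two_hermiteProd v).integrable (by norm_num)).const_mul _,
      Finset.sum_eq_zero, mul_zero]
    intro v hv
    rw [integral_const_mul, integral_hermiteProd_eq_zero (ne_zero_of_mem_Nplus hκ ((hT v).1 hv).1),
      mul_zero]
  · filter_upwards [eventually_mul_pow_le_covInt hη hL hΔ hd hv₀d 1, eventually_gt_atTop 0]
      with r h1 h2
    refine lt_of_lt_of_le (mul_pos hc₀pos (lt_of_lt_of_le ?_ h1)) (hSlow r)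
    positivity
  -- Chosen so that `2 * ε' * ‖G‖² ≤ ε * c₀`; the `+ 1` keeps the denominator positive.
  · set ε' : ℝ := ε * c₀ / (2 * (‖hG.toLp G‖ ^ 2 + 1)) with hε'
    filter_upwards [eventually_forall_covInt_le_mul hη hL hΔ hd hv₀d
      (ε := ε') (by positivity)] with r hr
    have hI := covInt_nonneg (Δ := Δ) hη hL v₀ r
    have hle := integral_sq_integral_sub_le hη hL hG (volume.restrict (r • Δ)) T
      (b := ε' * covInt P η Δ v₀ r) (by positivity) fun v hvT hv ↦ ?_
    · rw [integral_congr_ae (g := fun ω ↦ ((∫ x in r • Δ, G (fun j ↦ η j x ω)) -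
        ∫ x in r • Δ, ∑ v ∈ T, c v * hermiteProd v (fun j ↦ η j x ω)) ^ 2)
        ((hS r).mono fun ω h ↦ by simp only [h])]
      refine hle.trans (le_trans ?_ (mul_le_mul_of_nonneg_left (hSlow r) hε.le))
      have h1 : 2 * (ε' * ‖hG.toLp G‖ ^ 2) ≤ ε * c₀ := by
        rw [hε', div_mul_eq_mul_div, mul_div_assoc', div_le_iff₀ (by positivity)]
        nlinarith [mul_pos hε hc₀pos]
      nlinarith [mul_le_mul_of_nonneg_right h1 hI]
    -- A multi-index outside `T` with nonzero coefficient lies in `Nplus` but misses the minimum, so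
    -- its exponent is strictly larger than `γ`.
    · have hvN := mem_Nplus_of_hermiteCoeff_ne_zero hκ hG0 hv
      refine hr v (hv₀γ ▸ lt_of_le_of_ne (hmin ⟨v, hvN, rfl⟩) fun h ↦ hvT ((hT v).2 ⟨hvN, h.symm⟩))

end Reduction

end HermiteReduction

/-- Existence of one limit law implying existence of the other, with the same law, is expressed as
an equivalence for every candidate law `μ`. -/
theorem theorem3 {d m n : ℕ} {Ω : Type*} [MeasurableSpace Ω]
    (P : MeasureTheory.Measure Ω) [MeasureTheory.IsProbabilityMeasure P]
    (Δ : Set (EuclideanSpace ℝ (Fin d))) (hΔ : HermiteReduction.IsWindow Δ)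
    (β : Fin m → ℝ) (hβ : ∀ i, (d : ℝ) < β i)
    (α : Fin n → ℝ) (hα_pos : ∀ j, 0 < α j) (hα : ∀ j, α j < (d : ℝ))
    (L : Fin m ⊕ Fin n → ℝ → ℝ) (hL : ∀ j, HermiteReduction.SlowlyVarying (L j))
    (η : Fin m ⊕ Fin n → EuclideanSpace ℝ (Fin d) → Ω → ℝ)
    (hη : HermiteReduction.IsGaussianVectorField P η (Sum.elim β α) L)
    (G : (Fin m ⊕ Fin n → ℝ) → ℝ)
    (hG : MeasureTheory.MemLp G 2 (HermiteReduction.stdGaussianMeasure (Fin m ⊕ Fin n)))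
    (hG_mean : HermiteReduction.hermiteCoeff G 0 = 0)
    (κ : ℕ) (hκ : HermiteReduction.IsHermiteRank G κ)
    (γ : ℝ)
    (hγ : IsLeast (HermiteReduction.exponentSum (Sum.elim β α) '' HermiteReduction.Nplus G κ) γ)
    (hγd : γ < (d : ℝ)) :
    ∀ (μ : MeasureTheory.Measure ℝ) [MeasureTheory.IsProbabilityMeasure μ],
      HermiteReduction.NormalizedLimit P (HermiteReduction.windowIntegral Δ η G) μ ↔
        HermiteReduction.NormalizedLimit P
          (HermiteReduction.KstarSum Δ η G κ (Sum.elim β α) γ) μ := by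
  have he : ∀ j, 0 < Sum.elim β α j := by
    rintro (i | j)
    · exact (Nat.cast_nonneg d).trans_lt (hβ i)
    · exact hα_pos j
  exact fun μ _ ↦ HermiteReduction.normalizedLimit_windowIntegral_iff hη hL hΔ he hG hG_mean hκ hγ
    hγd μ
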